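/- Let $d\in\{2,3\}$ and let $\Omega\subset\mathbb{R}^d$ be a bounded polyhedral domain, i.e. a nonempty connected open set that is the interior of its closure and whose closure is a finite union of convex polytopes. Let $\gamma>0$. For a conforming simplicial triangulation $\mathcal{T}_h$ of $\overline\Omega$ let $\varphi_1,\dots,\varphi_n$ be the nodal basis of the first order finite element space $V_h=\{u\in H^1_0(\Omega): u|_K\in P_1(K)\ \forall K\in\mathcal{T}_h\}$: $\varphi_i$ is continuous on $\overline\Omega$, affine on each simplex of $\mathcal{T}_h$, equal to $1$ at the $i$-th vertex of $\mathcal{T}_h$ lying in $\Omega$ and equal to $0$ at all other vertices. With the complex $L^2(\Omega)$ inner product $(\cdot,\cdot)$, and for $\kappa,\sigma\in\mathbb{R}$ with $\sigma>0$, put $$a(u,v)=(\nabla u,\nabla v)-\kappa^2(u,v)+\mathrm{i}(\sigma u,v),$$ and define the $n\times n$ matrices $$A_{ji}=a(\varphi_i,\varphi_j),\qquad K_{ji}=(\nabla\varphi_i,\nabla\varphi_j),\qquad M_{ji}=(\varphi_i,\varphi_j).$$ For $B\in\mathbb{C}^{n\times n}$ let $\mathcal{F}(B)=\{x^*Bx/x^*x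 : x\in\mathbb{C}^n,\ x\neq 0\}$ be its field of values. Then there are constants $c,C>0$, which depend only on $d$, $\Omega$ and $\gamma$ (in particular not on $h$, $\sigma$ or $\kappa$), such that for every such triangulation $\mathcal{T}_h$ that is quasi-uniform in the sense that each of its $d$-dimensional simplices has diameter at most $h$ and contains a ball of radius $h/\gamma$, and for all $\kappa\in\mathbb{R}$ and $\sigma>0$, $$\mathcal{F}(AK^{-1}M)\subset\bigl[\,c\,(1-C\kappa^2)\,h^d,\ C\,h^d\,\bigr]\times[\,0,\ C\sigma h^d\,],$$ where $[a,b]\times[a',b']$ denotes the set of $z\in\mathbb{C}$ with $a\le\operatorname{Re}z\le b$ and $a'\le\operatorname{Im}z\le b'$. -/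

import Mathlib

open MeasureTheory
open scoped ContDiff

namespace HelmholtzFEM

/-- The space `ℝ^d` with its Euclidean norm and Lebesgue measure. -/
abbrev E (d : ℕ) : Type := EuclideanSpace ℝ (Fin d)

/-- Bounded polyhedral domains: connected nonempty open sets that lie on one side of their boundary
(no slits) and whose closure is a finite union of (possibly degenerate) convex polytopes. -/
structure IsPolyhedralDomain {d : ℕ} (Ω : Set (E d)) : Prop where
  isOpen : IsOpen Ω
  isConnected : IsConnected Ω
  interior_closure : interior (closure Ω) = Ω
  polyhedral : ∃ P : Finset (Finset (E d)), closure Ω = ⋃ s ∈ P, convexHull ℝ (s : Set (E d))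

/-- A triangulation (`d = 2`) or tetrahedralization (`d = 3`) of `Ω`: a finite conforming simplicial
complex whose union is the closure of `Ω`, and in which every simplex is a face of a
`d`-dimensional one. -/
structure Triangulation {d : ℕ} (Ω : Set (E d)) extends Geometry.SimplicialComplex ℝ (E d) where
  finite_faces : faces.Finite
  space_eq : toSimplicialComplex.space = closure Ω
  pure_dim : ∀ s ∈ faces, ∃ t ∈ faces, s ⊆ t ∧ t.card = d + 1

namespace Triangulation

variable {d : ℕ} {Ω : Set (E d)}

/-- The elements of the triangulation: the vertex sets of its `d`-dimensional simplices. -/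
def cells (T : Triangulation Ω) : Set (Finset (E d)) :=
  {s | s ∈ T.faces ∧ s.card = d + 1}

/-- Quasi-uniformity with mesh size `h` and constant `γ`: every element has diameter at most `h` and
contains a ball of radius `h / γ`. -/
def IsQuasiUniform (T : Triangulation Ω) (γ h : ℝ) : Prop :=
  ∀ s ∈ T.cells, Metric.diam (convexHull ℝ (s : Set (E d))) ≤ h ∧
    ∃ c : E d, Metric.closedBall c (h / γ) ⊆ convexHull ℝ (s : Set (E d))

open Classical in
/-- The nodes, i.e. the vertices of the triangulation that lie in the open set `Ω`; the
homogeneous Dirichlet condition removes the vertices on the boundary. -/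
noncomputable def nodes (T : Triangulation Ω) : Finset (E d) :=
  (T.finite_faces.toFinset.biUnion id).filter (fun p => p ∈ Ω)

/-- `w` is the family of barycentric coordinates of the point `x` of the simplex with vertex
set `s`, extended by zero to all other points. -/
def IsBarycentric (s : Finset (E d)) (x : E d) (w : E d → ℝ) : Prop :=
  (∀ q, 0 ≤ w q) ∧ (∀ q, q ∉ s → w q = 0) ∧ ∑ q ∈ s, w q = 1 ∧ ∑ q ∈ s, w q • q = x

open Classical in
/-- The barycentric coordinates of `x` in a simplex of the triangulation that contains `x` (they do
not depend on that simplex), and zero if `x` is not in the closure of `Ω`. -/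
noncomputable def bary (T : Triangulation Ω) (x : E d) : E d → ℝ :=
  if hx : ∃ w, ∃ s ∈ T.faces, IsBarycentric s x w then hx.choose else 0

/-- The nodal basis function of first order elements at the vertex `p`: continuous on the closure
of `Ω`, affine on each element, equal to one at `p` and to zero at every other vertex. On each
element containing `p` it is the barycentric coordinate of `p`. -/
noncomputable def nodalBasis (T : Triangulation Ω) (p : T.nodes) (x : E d) : ℂ :=
  (T.bary x (p : E d) : ℂ)

lemma IsBarycentric.mem_convexHull {s : Finset (E d)} {x : E d} {w : E d → ℝ}
    (hw : IsBarycentric s x w) : x ∈ convexHull ℝ (s : Set (E d)) := by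
  obtain ⟨h0, -, h1, hx⟩ := hw
  rw [Finset.mem_convexHull']
  exact ⟨w, fun q _ => h0 q, h1, hx⟩

/-- Barycentric coordinates with respect to two subsets of one simplex agree. -/
lemma IsBarycentric.eq_of_subset {s t : Finset (E d)} {x : E d} {w v : E d → ℝ}
    (hs : AffineIndependent ℝ ((↑) : s → E d)) (hts : t ⊆ s)
    (hw : IsBarycentric s x w) (hv : IsBarycentric t x v) : w = v := by
  obtain ⟨-, hw0, hw1, hwx⟩ := hw
  obtain ⟨-, hv0, hv1, hvx⟩ := hv
  have hv1' : ∑ q ∈ s, v q = 1 := by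
    rw [← hv1]; exact (Finset.sum_subset hts fun q _ hq => hv0 q hq).symm
  have hvx' : ∑ q ∈ s, v q • q = x := by
    rw [← hvx]; exact (Finset.sum_subset hts fun q _ hq => by rw [hv0 q hq, zero_smul]).symm
  have key := (affineIndependent_iff.1 hs) Finset.univ (fun q => w q - v q)
    (by rw [Finset.sum_coe_sort s (fun q => w q - v q), Finset.sum_sub_distrib, hw1, hv1', sub_self])
    (by
      rw [Finset.sum_coe_sort s (fun q => (w q - v q) • q)]
      simp only [sub_smul]
      rw [Finset.sum_sub_distrib, hwx, hvx', sub_self])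
  funext q
  by_cases hq : q ∈ s
  · exact sub_eq_zero.1 (key ⟨q, hq⟩ (Finset.mem_univ _))
  · rw [hw0 q hq, hv0 q fun h => hq (hts h)]

/-- The barycentric coordinates in the definition of `bary` do not depend on the simplex. -/
lemma bary_eq (T : Triangulation Ω) {s : Finset (E d)} {x : E d} {w : E d → ℝ}
    (hs : s ∈ T.faces) (hw : IsBarycentric s x w) : T.bary x = w := by
  classical
  have hex : ∃ w, ∃ s ∈ T.faces, IsBarycentric s x w := ⟨w, s, hs, hw⟩
  obtain ⟨t, ht, hv⟩ := hex.choose_spec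
  have hx := T.inter_subset_convexHull hs ht ⟨hw.mem_convexHull, hv.mem_convexHull⟩
  rw [← Finset.coe_inter, Finset.mem_convexHull'] at hx
  obtain ⟨u, hu0, hu1, hux⟩ := hx
  have hu : IsBarycentric (s ∩ t) x (fun q => if q ∈ s ∩ t then u q else 0) := by
    refine ⟨fun q => ?_, fun q hq => if_neg hq, ?_, ?_⟩
    · by_cases hq : q ∈ s ∩ t
      · simpa only [if_pos hq] using hu0 q hq
      · simp only [if_neg hq, le_refl]
    · rw [← hu1]; exact Finset.sum_congr rfl fun q hq => if_pos hq
    · rw [← hux]; exact Finset.sum_congr rfl fun q hq => by simp only [if_pos hq]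
  rw [bary, dif_pos hex, hw.eq_of_subset (T.indep hs) Finset.inter_subset_left hu]
  exact hv.eq_of_subset (T.indep ht) Finset.inter_subset_right hu

end Triangulation

section Forms

variable {d : ℕ}

/-- `g` is the weak gradient on `Ω` of a function `u` in `H¹(Ω)`: both are square integrable
and `∫_Ω u ∂ᵢη = -∫_Ω gᵢ η` for every smooth `η` with compact support in `Ω`. -/
def IsWeakGradient (Ω : Set (E d)) (u : E d → ℂ) (g : E d → Fin d → ℂ) : Prop :=
  MemLp u 2 (volume.restrict Ω) ∧ (∀ i, MemLp (fun x => g x i) 2 (volume.restrict Ω)) ∧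
    ∀ η : E d → ℝ, ContDiff ℝ ∞ η → HasCompactSupport η → tsupport η ⊆ Ω → ∀ i : Fin d,
      ∫ x in Ω, (fderiv ℝ η x (EuclideanSpace.single i 1) : ℂ) * u x =
        -∫ x in Ω, (η x : ℂ) * g x i

open Classical in
/-- The weak gradient on `Ω` of a function in `H¹(Ω)`; it is unique up to null sets. -/
noncomputable def weakGrad (Ω : Set (E d)) (u : E d → ℂ) : E d → Fin d → ℂ :=
  if hu : ∃ g, IsWeakGradient Ω u g then hu.choose else 0

/-- The `L²(Ω)` inner product `(u, v)`, linear in `u` and conjugate linear in `v`. -/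
noncomputable def massForm (Ω : Set (E d)) (u v : E d → ℂ) : ℂ :=
  ∫ x in Ω, u x * star (v x)

/-- The form `(∇u, ∇v)`. -/
noncomputable def stiffnessForm (Ω : Set (E d)) (u v : E d → ℂ) : ℂ :=
  ∫ x in Ω, ∑ i, weakGrad Ω u x i * star (weakGrad Ω v x i)

/-- The Helmholtz form `a(u, v) = (∇u, ∇v) - κ² (u, v) + i (σ u, v)` for constant `σ`. -/
noncomputable def helmholtzForm (Ω : Set (E d)) (κ σ : ℝ) (u v : E d → ℂ) : ℂ :=
  stiffnessForm Ω u v - (κ : ℂ) ^ 2 * massForm Ω u v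
    + Complex.I * massForm Ω (fun x => (σ : ℂ) * u x) v

/-- The matrix of a sesquilinear form `b` with respect to `φ`: the entry at `(j, i)` is
`b (φ i) (φ j)`. -/
def galerkinMatrix {ι : Type*} (b : (E d → ℂ) → (E d → ℂ) → ℂ) (φ : ι → E d → ℂ) :
    Matrix ι ι ℂ :=
  Matrix.of fun j i => b (φ i) (φ j)

variable {Ω : Set (E d)}

/-- The mass matrix `M`. -/
noncomputable def massMatrix (T : Triangulation Ω) : Matrix T.nodes T.nodes ℂ :=
  galerkinMatrix (massForm Ω) T.nodalBasis

/-- The stiffness matrix `K`. -/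
noncomputable def stiffnessMatrix (T : Triangulation Ω) : Matrix T.nodes T.nodes ℂ :=
  galerkinMatrix (stiffnessForm Ω) T.nodalBasis

/-- The system matrix `A` of the Helmholtz problem. -/
noncomputable def systemMatrix (T : Triangulation Ω) (κ σ : ℝ) : Matrix T.nodes T.nodes ℂ :=
  galerkinMatrix (helmholtzForm Ω κ σ) T.nodalBasis

end Forms

/-- The field of values `{x* B x / x* x | x ≠ 0}` of a square matrix. -/
def fieldOfValues {ι : Type*} [Fintype ι] (B : Matrix ι ι ℂ) : Set ℂ :=
  {z | ∃ x : ι → ℂ, x ≠ 0 ∧ z = (star x ⬝ᵥ B.mulVec x) / (star x ⬝ᵥ x)}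

end HelmholtzFEM

/-! Since `A = K + (-κ² + iσ) M`, the matrix in question is `A K⁻¹ M = M + (-κ² + iσ) M K⁻¹ M`,
where `M` and `M K⁻¹ M` are real symmetric. Its field of values therefore has real part governed by
`M - κ² M K⁻¹ M` and imaginary part by `σ M K⁻¹ M`. Poincaré's inequality `M ≤ P K` yields `0 ≤ M
K⁻¹ M ≤ P M` (`dotProduct_mul_inv_mul_mulVec_mem_Icc`), so everything reduces to the fact that `M`
is comparable to `h ^ d` times the identity.

The upper bound `realMass_le` is a weighted Cauchy–Schwarz inequality, each basis function being
supported in a ball of radius `h`. For the lower bound `le_realMass`, shrink the ball inscribed in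
each cell towards the vertex with the largest nodal value: on the smaller ball the function is at
least half that value in modulus, and balls of distinct cells are disjoint.

The analytic input is that nodal basis functions extended by zero are Lipschitz on the whole space
(`exists_lipschitzWith_bary`), so that their weak gradients are the classical ones almost
everywhere. This rests on `mem_of_bary_ne_zero`, where `interior (closure Ω) = Ω` enters. -/

/-! ### A local criterion for Lipschitz functions -/

/-- A function that is Lipschitz with constant `L` in the limit at every point of a real normed
space is Lipschitz with constant `L`. -/
lemma lipschitzWith_of_eventually_nhds {V : Type*} [NormedAddCommGroup V] [NormedSpace ℝ V]
    {f : V → ℝ} {L : NNReal}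
    (hf : ∀ x, ∀ᶠ y in nhds x, |f y - f x| ≤ L * ‖y - x‖) : LipschitzWith L f := by
  have hcont : Continuous f := by
    rw [continuous_iff_continuousAt]
    intro x
    rw [ContinuousAt, tendsto_iff_norm_sub_tendsto_zero]
    refine squeeze_zero' (Filter.Eventually.of_forall fun _ => norm_nonneg _) (hf x) ?_
    have : Continuous fun y : V => (L : ℝ) * ‖y - x‖ := by fun_prop
    simpa using this.tendsto x
  refine LipschitzWith.of_dist_le_mul fun y x => ?_
  rw [Real.dist_eq, dist_eq_norm]
  set p : ℝ → V := fun t => x + t • (y - x) with hp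
  have hpc : Continuous p := by fun_prop
  have key := image_norm_le_of_liminf_right_slope_norm_lt_deriv_boundary
    (f := fun t => f (p t) - f x) (f' := fun _ => L * ‖y - x‖) (a := 0) (b := 1)
  -- The mean value inequality along the segment from `x` to `y` needs a strict comparison of
  -- slopes; `ε` supplies it.
  have hsmall : ∀ ε : ℝ, 0 < ε → |f y - f x| ≤ L * ‖y - x‖ + ε := by
    intro ε hε
    have := key (by fun_prop) ?_ (B := fun t => (L * ‖y - x‖ + ε) * t)
      (B' := fun _ => L * ‖y - x‖ + ε) (by simp [hp]) (by fun_prop) ?_ ?_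
      (show (1 : ℝ) ∈ Set.Icc 0 1 by simp)
    · simpa [hp] using this
    · intro t _ r hr
      refine Filter.Eventually.frequently ?_
      have h1 : ∀ᶠ z in nhdsWithin t (Set.Ioi t), |f (p z) - f (p t)| ≤ L * ‖p z - p t‖ :=
        (hpc.continuousWithinAt.tendsto).eventually (hf (p t))
      filter_upwards [h1, self_mem_nhdsWithin] with z hz hzt
      have hzt' : 0 < z - t := sub_pos.2 hzt
      refine lt_of_le_of_lt ?_ hr
      rw [slope_def_field, div_le_iff₀ hzt']
      have h2 : p z - p t = (z - t) • (y - x) := by simp only [hp]; module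
      rw [h2, norm_smul, Real.norm_eq_abs, abs_of_pos hzt'] at hz
      have h3 := norm_sub_norm_le (f (p z) - f x) (f (p t) - f x)
      simp only [Function.comp, Real.norm_eq_abs] at h3 ⊢
      have h4 : f (p z) - f x - (f (p t) - f x) = f (p z) - f (p t) := by ring
      rw [h4] at h3
      linarith
    · intro t _
      simpa using ((hasDerivAt_id t).const_mul (L * ‖y - x‖ + ε)).hasDerivWithinAt
    · intro t _ _
      linarith
  exact le_of_forall_pos_le_add hsmall

/-! ### Barycentric coordinates and Lipschitz continuity of nodal basis functions -/

namespace HelmholtzFEM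

namespace Triangulation

variable {d : ℕ} {Ω : Set (E d)}

lemma finite_cells (T : Triangulation Ω) : T.cells.Finite :=
  T.finite_faces.subset fun _ h => h.1

/-- The vertices of a cell as an affine basis. -/
noncomputable def cellBasis (T : Triangulation Ω) {s : Finset (E d)} (hs : s ∈ T.cells) :
    AffineBasis s ℝ (E d) :=
  ⟨((↑) : s → E d), T.indep hs.1, by
    rw [(T.indep hs.1).affineSpan_eq_top_iff_card_eq_finrank_add_one]
    simp [hs.2]⟩

lemma cellBasis_apply (T : Triangulation Ω) {s : Finset (E d)} (hs : s ∈ T.cells) (q : s) :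
    T.cellBasis hs q = q := rfl

lemma mem_convexHull_iff_coord (T : Triangulation Ω) {s : Finset (E d)} (hs : s ∈ T.cells)
    {x : E d} : x ∈ convexHull ℝ (s : Set (E d)) ↔ ∀ q, 0 ≤ (T.cellBasis hs).coord q x := by
  have h := (T.cellBasis hs).convexHull_eq_nonneg_coord
  have hr : Set.range (T.cellBasis hs) = (s : Set (E d)) := Subtype.range_coe
  rw [hr] at h
  rw [h, Set.mem_ofPred_eq]

open Classical in
lemma isBarycentric_coord (T : Triangulation Ω) {s : Finset (E d)} (hs : s ∈ T.cells)
    {x : E d} (hx : x ∈ convexHull ℝ (s : Set (E d))) :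
    IsBarycentric s x fun q => if h : q ∈ s then (T.cellBasis hs).coord ⟨q, h⟩ x else 0 := by
  refine ⟨fun q => ?_, fun q hq => dif_neg hq, ?_, ?_⟩
  · dsimp only
    split_ifs with h
    · exact (T.mem_convexHull_iff_coord hs).1 hx _
    · exact le_rfl
  · rw [← (T.cellBasis hs).sum_coord_apply_eq_one x, ← Finset.sum_coe_sort s]
    simp
  · conv_rhs => rw [← (T.cellBasis hs).linear_combination_coord_eq_self x]
    rw [← Finset.sum_coe_sort s]
    simp [cellBasis_apply]

lemma bary_eq_coord (T : Triangulation Ω) {s : Finset (E d)} (hs : s ∈ T.cells)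
    {x : E d} (hx : x ∈ convexHull ℝ (s : Set (E d))) (q : s) :
    T.bary x q = (T.cellBasis hs).coord q x := by
  rw [T.bary_eq hs.1 (T.isBarycentric_coord hs hx)]
  simp

lemma isBarycentric_bary (T : Triangulation Ω) {s : Finset (E d)} (hs : s ∈ T.cells)
    {x : E d} (hx : x ∈ convexHull ℝ (s : Set (E d))) : IsBarycentric s x (T.bary x) := by
  have h := T.isBarycentric_coord hs hx
  rwa [T.bary_eq hs.1 h]

lemma exists_cell (T : Triangulation Ω) {x : E d} (hx : x ∈ closure Ω) :
    ∃ s ∈ T.cells, x ∈ convexHull ℝ (s : Set (E d)) := by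
  rw [← T.space_eq, Geometry.SimplicialComplex.mem_space_iff] at hx
  obtain ⟨s, hs, hx⟩ := hx
  obtain ⟨t, ht, hst, hc⟩ := T.pure_dim s hs
  exact ⟨t, ⟨ht, hc⟩, convexHull_mono (by exact_mod_cast hst) hx⟩

lemma convexHull_subset_closure (T : Triangulation Ω) {s : Finset (E d)} (hs : s ∈ T.cells) :
    convexHull ℝ (s : Set (E d)) ⊆ closure Ω := by
  intro x hx
  rw [← T.space_eq, Geometry.SimplicialComplex.mem_space_iff]
  exact ⟨s, hs.1, hx⟩

/-- The default value in `bary` is what extends the nodal basis functions by zero to the whole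
space. -/
lemma bary_of_notMem_closure (T : Triangulation Ω) {x : E d} (hx : x ∉ closure Ω) :
    T.bary x = 0 := by
  rw [bary, dif_neg]
  rintro ⟨w, s, hs, hw⟩
  refine hx ?_
  rw [← T.space_eq, Geometry.SimplicialComplex.mem_space_iff]
  exact ⟨s, hs, hw.mem_convexHull⟩

lemma bary_nonneg (T : Triangulation Ω) (x q : E d) : 0 ≤ T.bary x q := by
  by_cases hx : x ∈ closure Ω
  · obtain ⟨s, hs, hxs⟩ := T.exists_cell hx
    exact (T.isBarycentric_bary hs hxs).1 q
  · simp [T.bary_of_notMem_closure hx]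

lemma exists_cell_of_bary_ne_zero (T : Triangulation Ω) {x q : E d} (hq : T.bary x q ≠ 0) :
    ∃ s ∈ T.cells, q ∈ s ∧ x ∈ convexHull ℝ (s : Set (E d)) := by
  have hx : x ∈ closure Ω := by
    by_contra hx
    exact hq (by simp [T.bary_of_notMem_closure hx])
  obtain ⟨s, hs, hxs⟩ := T.exists_cell hx
  refine ⟨s, hs, ?_, hxs⟩
  by_contra h
  exact hq ((T.isBarycentric_bary hs hxs).2.1 q h)

lemma sum_bary_le_one (T : Triangulation Ω) (F : Finset (E d)) (x : E d) :
    ∑ q ∈ F, T.bary x q ≤ 1 := by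
  classical
  by_cases hx : x ∈ closure Ω
  · obtain ⟨s, hs, hxs⟩ := T.exists_cell hx
    have hb := T.isBarycentric_bary hs hxs
    calc ∑ q ∈ F, T.bary x q ≤ ∑ q ∈ F ∪ s, T.bary x q :=
          Finset.sum_le_sum_of_subset_of_nonneg Finset.subset_union_left
            fun q _ _ => T.bary_nonneg x q
      _ = ∑ q ∈ s, T.bary x q :=
          (Finset.sum_subset Finset.subset_union_right fun q _ hq => hb.2.1 q hq).symm
      _ = 1 := hb.2.2.1
      _ ≤ 1 := le_rfl
  · simp [T.bary_of_notMem_closure hx]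

lemma bary_le_one (T : Triangulation Ω) (x q : E d) : T.bary x q ≤ 1 := by
  simpa using T.sum_bary_le_one {q} x

lemma isClosed_convexHull_finset (s : Finset (E d)) :
    IsClosed (convexHull ℝ (s : Set (E d))) :=
  (s.finite_toSet.isCompact_convexHull ℝ).isClosed

/-- Near `x` only the cells that contain `x` matter. -/
lemma eventually_mem_cell_imp (T : Triangulation Ω) (x : E d) :
    ∀ᶠ y in nhds x, ∀ s ∈ T.cells, y ∈ convexHull ℝ (s : Set (E d)) →
      x ∈ convexHull ℝ (s : Set (E d)) := by
  rw [Filter.eventually_all_finite T.finite_cells]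
  intro s _
  by_cases hx : x ∈ convexHull ℝ (s : Set (E d))
  · exact Filter.Eventually.of_forall fun _ _ => hx
  · filter_upwards [(isClosed_convexHull_finset s).isOpen_compl.mem_nhds hx] with y hy hy'
    exact absurd hy' hy

/-- The open star of a vertex in `Ω` lies in `Ω`. -/
lemma mem_of_bary_ne_zero (hΩ : IsPolyhedralDomain Ω) (T : Triangulation Ω) {p x : E d}
    (hp : p ∈ Ω) (hx : T.bary x p ≠ 0) : x ∈ Ω := by
  classical
  obtain ⟨s, hs, hps, hxs⟩ := T.exists_cell_of_bary_ne_zero hx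
  have hpos : 0 < T.bary x p := lt_of_le_of_ne (T.bary_nonneg x p) hx.symm
  have hline : ∀ y : E d, Continuous fun l : ℝ => AffineMap.lineMap (k := ℝ) p y l := fun y => by
    fun_prop
  -- Slide `x` towards `p` until it lies in the open set `Ω`. The cells around this intermediate
  -- point control the surroundings of `x`.
  obtain ⟨l, hlΩ, hl0, hl1⟩ : ∃ l : ℝ, AffineMap.lineMap p x l ∈ Ω ∧ 0 < l ∧ l < 1 := by
    have h1 : ∀ᶠ l : ℝ in nhdsWithin 0 (Set.Ioi 0), AffineMap.lineMap p x l ∈ Ω := by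
      refine ((hline x).tendsto' 0 p (by simp)).mono_left nhdsWithin_le_nhds ?_
      exact hΩ.isOpen.mem_nhds hp
    have h2 : ∀ᶠ l : ℝ in nhdsWithin 0 (Set.Ioi 0), l ∈ Set.Ioo (0 : ℝ) 1 :=
      Ioo_mem_nhdsGT one_pos
    obtain ⟨l, h⟩ := (h1.and h2).exists
    exact ⟨l, h.1, h.2⟩
  have hxl : IsBarycentric s (AffineMap.lineMap p x l)
      (fun q => l * T.bary x q + (1 - l) * if q = p then 1 else 0) := by
    obtain ⟨b0, b1, b2, b3⟩ := T.isBarycentric_bary hs hxs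
    refine ⟨fun q => ?_, fun q hq => ?_, ?_, ?_⟩
    · have := b0 q
      have h3 : (0 : ℝ) ≤ if q = p then 1 else 0 := by split_ifs <;> norm_num
      have h4 : 0 ≤ 1 - l := by linarith
      positivity
    · have : q ≠ p := fun h => hq (h ▸ hps)
      simp [b1 q hq, this]
    · simp [Finset.sum_add_distrib, ← Finset.mul_sum, b2, hps]
    · simp only [add_smul, mul_smul, Finset.sum_add_distrib, ← Finset.smul_sum, b3]
      simp only [ite_smul, one_smul, zero_smul, Finset.sum_ite_eq', hps, if_true]
      rw [AffineMap.lineMap_apply_module]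
      abel
  have hbl := T.bary_eq hs.1 hxl
  -- The intermediate point has positive coordinates at `p` and wherever `x` does, so a cell
  -- containing it has all these vertices, hence contains `x`.
  have hcell : ∀ t ∈ T.cells, AffineMap.lineMap p x l ∈ convexHull ℝ (t : Set (E d)) →
      p ∈ t ∧ x ∈ convexHull ℝ (t : Set (E d)) := by
    intro t ht hxt
    have hsup : ∀ q, T.bary x q ≠ 0 → q ∈ t := by
      intro q hq
      by_contra hqt
      have h0 := (T.isBarycentric_bary ht hxt).2.1 q hqt
      rw [hbl] at h0
      have h1 : 0 < T.bary x q := lt_of_le_of_ne (T.bary_nonneg x q) hq.symm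
      have h3 : (0 : ℝ) ≤ if q = p then 1 else 0 := by split_ifs <;> norm_num
      have h4 : 0 ≤ 1 - l := by linarith
      have : 0 < l * T.bary x q + (1 - l) * if q = p then 1 else 0 := by positivity
      exact this.ne' h0
    refine ⟨hsup p hx, ?_⟩
    obtain ⟨b0, b1, b2, b3⟩ := T.isBarycentric_bary hs hxs
    have e1 : ∑ q ∈ s ∩ t, T.bary x q = 1 := by
      rw [← b2]
      refine Finset.sum_subset Finset.inter_subset_left fun q hq hqt => ?_
      by_contra h
      exact hqt (Finset.mem_inter.2 ⟨hq, hsup q h⟩)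
    have e2 : ∑ q ∈ s ∩ t, T.bary x q • q = x := by
      conv_rhs => rw [← b3]
      refine Finset.sum_subset Finset.inter_subset_left fun q hq hqt => ?_
      by_contra h
      exact hqt (Finset.mem_inter.2 ⟨hq, hsup q fun h' => h (by rw [h', zero_smul])⟩)
    have e3 : x ∈ convexHull ℝ ((s ∩ t : Finset (E d)) : Set (E d)) := by
      rw [Finset.mem_convexHull']
      exact ⟨T.bary x, fun q _ => b0 q, e1, e2⟩
    exact convexHull_mono (by exact_mod_cast Finset.inter_subset_right) e3
  have hc2 : Continuous fun y : E d => AffineMap.lineMap (k := ℝ) p y l := by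
    simp only [AffineMap.lineMap_apply_module]
    fun_prop
  have ev1 : ∀ᶠ y in nhds x, AffineMap.lineMap p y l ∈ Ω :=
    hc2.tendsto x (hΩ.isOpen.mem_nhds hlΩ)
  have ev2 := hc2.tendsto x (T.eventually_mem_cell_imp (AffineMap.lineMap p x l))
  have ev3 : ∀ᶠ y in nhds x, ∀ t (ht : t ∈ T.cells), ∀ hpt : p ∈ t,
      x ∈ convexHull ℝ (t : Set (E d)) → 0 < (T.cellBasis ht).coord ⟨p, hpt⟩ y := by
    have : ∀ᶠ y in nhds x, ∀ t ∈ T.cells, ∀ ht : t ∈ T.cells, ∀ hpt : p ∈ t,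
      x ∈ convexHull ℝ (t : Set (E d)) → 0 < (T.cellBasis ht).coord ⟨p, hpt⟩ y := by
      rw [Filter.eventually_all_finite T.finite_cells]
      intro t ht
      by_cases hpt : p ∈ t
      · by_cases hxt : x ∈ convexHull ℝ (t : Set (E d))
        · have h0 : 0 < (T.cellBasis ht).coord ⟨p, hpt⟩ x := by
            rw [← T.bary_eq_coord ht hxt ⟨p, hpt⟩]
            exact hpos
          filter_upwards [(AffineMap.continuous_of_finiteDimensional
            ((T.cellBasis ht).coord ⟨p, hpt⟩)).tendsto x (lt_mem_nhds h0)] with y hy _ _ _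
          exact hy
        · exact Filter.Eventually.of_forall fun y _ _ h => absurd h hxt
      · exact Filter.Eventually.of_forall fun y _ h => absurd h hpt
    filter_upwards [this] with y hy t ht
    exact hy t ht ht
  -- For `y` near `x`, its image under the homothety with centre `p` and ratio `l` lies in some cell
  -- `t`. The coordinates of `y` in `t` away from `p` are those of the image divided by `l`, hence
  -- nonnegative; the one at `p` is positive by continuity. So `y` itself lies in `t`.
  have hmem : closure Ω ∈ nhds x := by
    filter_upwards [ev1, ev2, ev3] with y h1 h2 h3
    obtain ⟨t, ht, hyt⟩ := T.exists_cell (subset_closure h1)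
    obtain ⟨hpt, hxt⟩ := hcell t ht (h2 t ht hyt)
    refine T.convexHull_subset_closure ht ((T.mem_convexHull_iff_coord ht).2 fun q => ?_)
    by_cases hq : q = ⟨p, hpt⟩
    · rw [hq]; exact (h3 t ht hpt hxt).le
    · have h4 := (T.mem_convexHull_iff_coord ht).1 hyt q
      have h5 : (T.cellBasis ht).coord q p = 0 := by
        have := (T.cellBasis ht).coord_apply_ne hq
        rwa [cellBasis_apply] at this
      rw [AffineMap.apply_lineMap, h5, AffineMap.lineMap_apply_module] at h4
      simp only [smul_eq_mul, mul_zero, zero_add] at h4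
      exact (mul_nonneg_iff_of_pos_left hl0).1 h4
  rw [← hΩ.interior_closure]
  exact mem_interior_iff_mem_nhds.2 hmem

lemma exists_lipschitz_on_cell (T : Triangulation Ω) {s : Finset (E d)} (hs : s ∈ T.cells)
    (p : E d) : ∃ L : NNReal, ∀ x ∈ convexHull ℝ (s : Set (E d)),
      ∀ y ∈ convexHull ℝ (s : Set (E d)), |T.bary y p - T.bary x p| ≤ L * ‖y - x‖ := by
  by_cases hp : p ∈ s
  · let f := (T.cellBasis hs).coord ⟨p, hp⟩
    refine ⟨‖LinearMap.toContinuousLinearMap f.linear‖₊, fun x hx y hy => ?_⟩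
    rw [T.bary_eq_coord hs hx ⟨p, hp⟩, T.bary_eq_coord hs hy ⟨p, hp⟩]
    have h := (LinearMap.toContinuousLinearMap f.linear).le_opNorm (y - x)
    have h2 : LinearMap.toContinuousLinearMap f.linear (y - x) = f y - f x := by
      simpa using f.linearMap_vsub y x
    rw [h2] at h
    exact h
  · refine ⟨0, fun x hx y hy => ?_⟩
    rw [(T.isBarycentric_bary hs hx).2.1 p hp, (T.isBarycentric_bary hs hy).2.1 p hp]
    simp

/-- The nodal basis functions, extended by zero, are Lipschitz on the whole space. -/
lemma exists_lipschitzWith_bary (hΩ : IsPolyhedralDomain Ω) (T : Triangulation Ω) {p : E d}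
    (hp : p ∈ Ω) : ∃ L, LipschitzWith L fun x => T.bary x p := by
  classical
  choose! L hL using fun s (hs : s ∈ T.cells) => T.exists_lipschitz_on_cell hs p
  refine ⟨T.finite_cells.toFinset.sup L, lipschitzWith_of_eventually_nhds fun x => ?_⟩
  -- This excludes a jump across the boundary: points outside of the closure can be near `x` only if
  -- the function vanishes at `x`.
  have ev : ∀ᶠ y in nhds x, T.bary x p ≠ 0 → y ∈ Ω := by
    by_cases hx : T.bary x p = 0
    · exact Filter.Eventually.of_forall fun y h => absurd hx h
    · filter_upwards [hΩ.isOpen.mem_nhds (T.mem_of_bary_ne_zero hΩ hp hx)] with y hy _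
      exact hy
  filter_upwards [ev, T.eventually_mem_cell_imp x] with y h1 h2
  by_cases hy : y ∈ closure Ω
  · obtain ⟨s, hs, hys⟩ := T.exists_cell hy
    refine (hL s hs x (h2 s hs hys) y hys).trans ?_
    have : L s ≤ T.finite_cells.toFinset.sup L :=
      Finset.le_sup (f := L) (T.finite_cells.mem_toFinset.2 hs)
    gcongr
  · have hx : T.bary x p = 0 := by
      by_contra h
      exact hy (subset_closure (h1 h))
    rw [hx, T.bary_of_notMem_closure hy]
    simp only [Pi.zero_apply, sub_zero, abs_zero]
    positivity

lemma mem_of_mem_nodes (T : Triangulation Ω) (p : T.nodes) : (p : E d) ∈ Ω := by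
  classical
  exact (Finset.mem_filter.1 p.2).2

end Triangulation

end HelmholtzFEM

/-! ### Poincaré's inequality and weak gradients of Lipschitz functions -/

namespace HelmholtzFEM

lemma IsPolyhedralDomain.isCompact_closure {d : ℕ} {Ω : Set (E d)} (hΩ : IsPolyhedralDomain Ω) :
    IsCompact (closure Ω) := by
  obtain ⟨P, hP⟩ := hΩ.polyhedral
  rw [hP]
  exact P.isCompact_biUnion fun s _ => s.finite_toSet.isCompact_convexHull ℝ

lemma IsPolyhedralDomain.isFiniteMeasure {d : ℕ} {Ω : Set (E d)} (hΩ : IsPolyhedralDomain Ω) :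
    IsFiniteMeasure (volume.restrict Ω) :=
  isFiniteMeasure_restrict.2
    ((measure_mono subset_closure).trans_lt hΩ.isCompact_closure.measure_lt_top).ne

/-- The partial derivative of `u` in the `i`-th coordinate direction. -/
noncomputable def partialDeriv {d : ℕ} (u : E d → ℝ) (i : Fin d) (x : E d) : ℝ :=
  lineDeriv ℝ u x (EuclideanSpace.single i 1)

section

variable {d : ℕ} {L : NNReal} {u : E d → ℝ}

lemma abs_partialDeriv_le (hu : LipschitzWith L u) (i : Fin d) (x : E d) :
    |partialDeriv u i x| ≤ L := by
  simpa [partialDeriv] using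
    norm_lineDeriv_le_of_lipschitz ℝ (v := EuclideanSpace.single i (1 : ℝ)) (x₀ := x) hu

lemma measurable_partialDeriv (hu : LipschitzWith L u) (i : Fin d) :
    Measurable (partialDeriv u i) :=
  measurable_lineDeriv hu.continuous

lemma memLp_two_partialDeriv (hu : LipschitzWith L u) (i : Fin d) (μ : Measure (E d))
    [IsFiniteMeasure μ] : MemLp (partialDeriv u i) 2 μ :=
  MemLp.of_bound (measurable_partialDeriv hu i).aestronglyMeasurable L
    (Filter.Eventually.of_forall fun x => abs_partialDeriv_le hu i x)

/-- Poincaré's inequality for Lipschitz functions that vanish outside of a bounded set. -/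
lemma integral_sq_le_integral_partialDeriv_sq {Ω : Set (E d)} (hΩ : MeasurableSet Ω)
    [IsFiniteMeasure (volume.restrict Ω)] (hu : LipschitzWith L u) (hcu : HasCompactSupport u)
    (hu0 : ∀ x, x ∉ Ω → u x = 0) {R : ℝ} (hR : ∀ x ∈ Ω, ‖x‖ ≤ R) (i : Fin d) :
    ∫ x in Ω, u x ^ 2 ≤ 4 * R ^ 2 * ∫ x in Ω, partialDeriv u i x ^ 2 := by
  obtain ⟨B, hB⟩ := hcu.exists_bound_of_continuous hu.continuous
  have hB0 : 0 ≤ B := (norm_nonneg _).trans (hB 0)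
  -- Integration by parts below is applied to two Lipschitz functions, the square of `u` being the
  -- one with compact support.
  have hsq : LipschitzWith (2 * B.toNNReal * L) fun x => u x ^ 2 := by
    refine LipschitzWith.of_dist_le_mul fun x y => ?_
    have h1 := hu.dist_le_mul x y
    rw [Real.dist_eq] at h1 ⊢
    have h2 : u x ^ 2 - u y ^ 2 = (u x + u y) * (u x - u y) := by ring
    have h3 : |u x + u y| ≤ 2 * B := by
      have a := hB x
      have b := hB y
      rw [Real.norm_eq_abs] at a b
      exact (abs_add_le _ _).trans (by linarith)
    rw [h2, abs_mul]
    push_cast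
    rw [Real.coe_toNNReal _ hB0, mul_assoc]
    exact mul_le_mul h3 h1 (abs_nonneg _) (by positivity)
  have hcsq : HasCompactSupport fun x => u x ^ 2 :=
    hcu.comp_left (g := fun t : ℝ => t ^ 2) (by norm_num)
  -- With `∂ᵢxᵢ = 1`, integration by parts gives `∫ u² = -∫ 2 u (∂ᵢu) xᵢ`. As `|xᵢ| ≤ R`, Young's
  -- inequality bounds the integrand by `u²/2 + 2R²(∂ᵢu)²`; absorbing the first term produces the
  -- constant `4R²`.
  let c : E d →L[ℝ] ℝ := EuclideanSpace.proj i
  have key := c.lipschitz.integral_lineDeriv_mul_eq (μ := volume) hsq hcsq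
    (EuclideanSpace.single i (1 : ℝ))
  have h1 : ∀ x, lineDeriv ℝ c x (EuclideanSpace.single i (1 : ℝ)) = 1 := by
    intro x
    rw [c.differentiableAt.lineDeriv_eq_fderiv, c.fderiv]
    simp [c]
  have h2 : ∀ᵐ x, lineDeriv ℝ (fun x => u x ^ 2) x (-EuclideanSpace.single i (1 : ℝ)) * c x
      = -(2 * u x * partialDeriv u i x * c x) := by
    filter_upwards [hu.ae_differentiableAt (μ := volume)] with x hx
    have h3 : lineDeriv ℝ (fun x => u x ^ 2) x (-EuclideanSpace.single i (1 : ℝ)) = _ :=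
      ((hx.hasFDerivAt.pow 2).hasLineDerivAt _).lineDeriv
    rw [h3, partialDeriv, hx.lineDeriv_eq_fderiv]
    simp
  simp only [h1, one_mul] at key
  rw [integral_congr_ae h2] at key
  have hr1 : ∫ x in Ω, u x ^ 2 = ∫ x, u x ^ 2 :=
    setIntegral_eq_integral_of_forall_compl_eq_zero fun x hx => by simp [hu0 x hx]
  have hr2 : ∫ x in Ω, -(2 * u x * partialDeriv u i x * c x)
      = ∫ x, -(2 * u x * partialDeriv u i x * c x) :=
    setIntegral_eq_integral_of_forall_compl_eq_zero fun x hx => by simp [hu0 x hx]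
  rw [← hr1, ← hr2] at key
  have i1 : Integrable (fun x => u x ^ 2) (volume.restrict Ω) :=
    (hsq.continuous.integrable_of_hasCompactSupport hcsq).integrableOn
  have i2 : Integrable (fun x => partialDeriv u i x ^ 2) (volume.restrict Ω) :=
    (memLp_two_partialDeriv hu i _).integrable_sq
  have i3 := (i1.const_mul (1 / 2)).add (i2.const_mul (2 * R ^ 2))
  have hpt : ∀ᵐ x ∂volume.restrict Ω, ‖-(2 * u x * partialDeriv u i x * c x)‖
      ≤ 1 / 2 * u x ^ 2 + 2 * R ^ 2 * partialDeriv u i x ^ 2 := by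
    filter_upwards [ae_restrict_mem hΩ] with x hx
    have hc : |c x| ≤ R := (PiLp.norm_apply_le x i).trans (hR x hx)
    rw [norm_neg, Real.norm_eq_abs, abs_mul, abs_mul, abs_mul, abs_two]
    have h5 : 2 * |u x| * |partialDeriv u i x| * |c x| ≤
        2 * |u x| * |partialDeriv u i x| * R := by gcongr
    nlinarith [sq_nonneg (|u x| - 2 * R * |partialDeriv u i x|), sq_abs (u x),
      sq_abs (partialDeriv u i x)]
  have hle : ∫ x in Ω, -(2 * u x * partialDeriv u i x * c x)
      ≤ ∫ x in Ω, (1 / 2 * u x ^ 2 + 2 * R ^ 2 * partialDeriv u i x ^ 2) := by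
    refine integral_mono_ae (i3.mono' ?_ hpt) i3 (hpt.mono fun x hx => (le_abs_self _).trans hx)
    have := measurable_partialDeriv hu i
    have := hu.continuous.measurable
    have := c.continuous.measurable
    exact (by fun_prop : Measurable _).aestronglyMeasurable
  rw [← key, integral_add (i1.const_mul _) (i2.const_mul _), integral_const_mul,
    integral_const_mul] at hle
  linarith

end

/-- Two weak gradients of the same function agree almost everywhere. -/
lemma IsWeakGradient.ae_eq {d : ℕ} {Ω : Set (E d)} (hΩ : IsOpen Ω) {u : E d → ℂ}
    {g g' : E d → Fin d → ℂ} (hg : IsWeakGradient Ω u g) (hg' : IsWeakGradient Ω u g') (i : Fin d) :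
    ∀ᵐ x ∂volume.restrict Ω, g x i = g' x i := by
  have hl : LocallyIntegrableOn (fun x => g x i - g' x i) Ω volume := by
    have h := (hg.2.1 i).sub (hg'.2.1 i)
    exact locallyIntegrableOn_of_locallyIntegrable_restrict (h.locallyIntegrable (by norm_num))
  rw [ae_restrict_iff' hΩ.measurableSet]
  have := hΩ.ae_eq_zero_of_integral_contDiff_smul_eq_zero hl ?_
  · filter_upwards [this] with x hx hxΩ
    exact sub_eq_zero.1 (hx hxΩ)
  · intro η h1 h2 h3
    have e := hg.2.2 η h1 h2 h3 i
    rw [hg'.2.2 η h1 h2 h3 i, neg_inj] at e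
    have hη : MemLp (fun x => (η x : ℂ)) 2 (volume.restrict Ω) :=
      ((h1.continuous.memLp_of_hasCompactSupport h2).restrict Ω).ofReal
    have i1 : Integrable (fun x => (η x : ℂ) * g x i) (volume.restrict Ω) :=
      hη.integrable_mul (hg.2.1 i)
    have i2 : Integrable (fun x => (η x : ℂ) * g' x i) (volume.restrict Ω) :=
      hη.integrable_mul (hg'.2.1 i)
    have e2 : ∫ x in Ω, η x • (g x i - g' x i) = ∫ x, η x • (g x i - g' x i) := by
      refine setIntegral_eq_integral_of_forall_compl_eq_zero fun x hx => ?_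
      have : η x = 0 := image_eq_zero_of_notMem_tsupport fun h => hx (h3 h)
      simp [this]
    rw [← e2]
    simp only [Complex.real_smul, mul_sub]
    rw [integral_sub i1 i2, e, sub_self]

/-- The classical gradient of a Lipschitz function vanishing outside of `Ω` is a weak gradient. -/
lemma isWeakGradient_ofReal {d : ℕ} {Ω : Set (E d)}
    [IsFiniteMeasure (volume.restrict Ω)] {L : NNReal} {u : E d → ℝ} (hu : LipschitzWith L u)
    (hcu : HasCompactSupport u) (hu0 : ∀ x, x ∉ Ω → u x = 0) :
    IsWeakGradient Ω (fun x => (u x : ℂ)) fun x i => (partialDeriv u i x : ℂ) := by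
  refine ⟨((hu.continuous.memLp_of_hasCompactSupport hcu).restrict Ω).ofReal,
    fun i => (memLp_two_partialDeriv hu i _).ofReal, fun η h1 h2 h3 i => ?_⟩
  obtain ⟨D, hD⟩ := h1.lipschitzWith_of_hasCompactSupport h2 (by simp)
  have key := hu.integral_lineDeriv_mul_eq (μ := volume) hD h2 (EuclideanSpace.single i (1 : ℝ))
  have h4 : ∀ x, lineDeriv ℝ η x (-EuclideanSpace.single i (1 : ℝ))
      = -fderiv ℝ η x (EuclideanSpace.single i 1) := fun x => by
    rw [(h1.differentiable (by simp) x).lineDeriv_eq_fderiv, map_neg]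
  simp only [h4, neg_mul, integral_neg] at key
  have e1 : ∫ x in Ω, lineDeriv ℝ u x (EuclideanSpace.single i (1 : ℝ)) * η x
      = ∫ x, lineDeriv ℝ u x (EuclideanSpace.single i (1 : ℝ)) * η x := by
    refine setIntegral_eq_integral_of_forall_compl_eq_zero fun x hx => ?_
    have : η x = 0 := image_eq_zero_of_notMem_tsupport fun h => hx (h3 h)
    simp [this]
  have e2 : ∫ x in Ω, fderiv ℝ η x (EuclideanSpace.single i 1) * u x
      = ∫ x, fderiv ℝ η x (EuclideanSpace.single i 1) * u x :=
    setIntegral_eq_integral_of_forall_compl_eq_zero fun x hx => by simp [hu0 x hx]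
  rw [← e1, ← e2] at key
  have e3 : ∫ x in Ω, η x * partialDeriv u i x
      = ∫ x in Ω, lineDeriv ℝ u x (EuclideanSpace.single i (1 : ℝ)) * η x := by
    simp only [partialDeriv, mul_comm]
  have e4 : ∫ x in Ω, fderiv ℝ η x (EuclideanSpace.single i 1) * u x
      = -∫ x in Ω, η x * partialDeriv u i x := by
    rw [e3, key, neg_neg]
  simp only [← Complex.ofReal_mul, integral_complex_ofReal]
  rw [e4, Complex.ofReal_neg]

/-- The representative chosen in `weakGrad` is determined only up to null sets, which suffices
because the stiffness form integrates it. -/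
lemma weakGrad_ae_eq {d : ℕ} {Ω : Set (E d)} (hΩ : IsOpen Ω)
    [IsFiniteMeasure (volume.restrict Ω)] {L : NNReal} {u : E d → ℝ} (hu : LipschitzWith L u)
    (hcu : HasCompactSupport u) (hu0 : ∀ x, x ∉ Ω → u x = 0) :
    ∀ᵐ x ∂volume.restrict Ω, ∀ i, weakGrad Ω (fun x => (u x : ℂ)) x i = partialDeriv u i x := by
  have hw := isWeakGradient_ofReal hu hcu hu0
  have hex : ∃ g, IsWeakGradient Ω (fun x => (u x : ℂ)) g := ⟨_, hw⟩
  rw [ae_all_iff]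
  intro i
  rw [weakGrad, dif_pos hex]
  exact hex.choose_spec.ae_eq hΩ hw i

end HelmholtzFEM

/-! ### Linear algebra of the field of values -/

open Matrix in
/-- If `M ≤ C K` with `K` positive definite and `M` positive semidefinite,
then `0 ≤ M K⁻¹ M ≤ C M`. -/
lemma dotProduct_mul_inv_mul_mulVec_mem_Icc {ι : Type*} [Fintype ι] [DecidableEq ι]
    {M K : Matrix ι ι ℝ} (hM : M.IsSymm) (hK : IsUnit K.det) {C : ℝ} (hC : 0 < C)
    (hM0 : ∀ a, 0 ≤ a ⬝ᵥ M *ᵥ a) (hMK : ∀ a, a ⬝ᵥ M *ᵥ a ≤ C * (a ⬝ᵥ K *ᵥ a)) (a : ι → ℝ) :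
    a ⬝ᵥ (M * K⁻¹ * M) *ᵥ a ∈ Set.Icc 0 (C * (a ⬝ᵥ M *ᵥ a)) := by
  set y := K⁻¹ *ᵥ (M *ᵥ a) with hy
  have hKy : K *ᵥ y = M *ᵥ a := by
    rw [hy, mulVec_mulVec, Matrix.mul_nonsing_inv K hK, one_mulVec]
  have hsymm : ∀ b c : ι → ℝ, b ⬝ᵥ M *ᵥ c = c ⬝ᵥ M *ᵥ b := fun b c => by
    rw [dotProduct_mulVec, ← mulVec_transpose, hM.eq, dotProduct_comm]
  have e1 : a ⬝ᵥ (M * K⁻¹ * M) *ᵥ a = a ⬝ᵥ M *ᵥ y := by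
    rw [hy, mulVec_mulVec, mulVec_mulVec]
  have e2 : a ⬝ᵥ M *ᵥ y = y ⬝ᵥ K *ᵥ y := by
    rw [hKy, hsymm]
  -- Write `m = aᵀMa` and `q = aᵀMy = yᵀKy`. Nonnegativity here reads `yᵀMy - 2Cq + C²m ≥ 0`;
  -- inserting `yᵀMy ≤ Cq` leaves `C(Cm - q) ≥ 0`.
  have h1 := hM0 (y - C • a)
  simp only [mulVec_sub, mulVec_smul, sub_dotProduct, dotProduct_sub, smul_dotProduct,
    dotProduct_smul, smul_eq_mul, hsymm y a] at h1
  have h2 := hMK y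
  rw [e1]
  rw [← e2] at h2
  have h3 : 0 ≤ a ⬝ᵥ M *ᵥ y := nonneg_of_mul_nonneg_right ((hM0 y).trans h2) hC
  refine ⟨h3, ?_⟩
  have h4 : 0 ≤ C * (C * (a ⬝ᵥ M *ᵥ a) - a ⬝ᵥ M *ᵥ y) := by nlinarith
  have := nonneg_of_mul_nonneg_right h4 hC
  linarith

open Matrix in
-- By symmetry the cross terms between real and imaginary parts cancel. This reduces complex vectors
-- to pairs of real ones.
lemma star_dotProduct_map_ofReal_mulVec {ι : Type*} [Fintype ι] {S : Matrix ι ι ℝ}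
    (hS : S.IsSymm) (x : ι → ℂ) :
    star x ⬝ᵥ (S.map ((↑) : ℝ → ℂ)) *ᵥ x =
      (((fun i => (x i).re) ⬝ᵥ S *ᵥ (fun i => (x i).re)
        + (fun i => (x i).im) ⬝ᵥ S *ᵥ (fun i => (x i).im) : ℝ) : ℂ) := by
  set a : ι → ℝ := fun i => (x i).re
  set b : ι → ℝ := fun i => (x i).im
  have hsymm : b ⬝ᵥ S *ᵥ a = a ⬝ᵥ S *ᵥ b := by
    rw [dotProduct_mulVec, ← mulVec_transpose, hS.eq, dotProduct_comm]
  have hv : ∀ c d : ι → ℝ, (fun i => (c i : ℂ)) ⬝ᵥ (S.map ((↑) : ℝ → ℂ)) *ᵥ (fun i => (d i : ℂ))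
      = ((c ⬝ᵥ S *ᵥ d : ℝ) : ℂ) := fun c d => by
    simp [dotProduct, mulVec]
  have hx : x = (fun i => (a i : ℂ)) + Complex.I • (fun i => (b i : ℂ)) := by
    ext i
    simp only [Pi.add_apply, Pi.smul_apply, smul_eq_mul, a, b]
    rw [mul_comm, Complex.re_add_im]
  have hsx : star x = (fun i => (a i : ℂ)) - Complex.I • (fun i => (b i : ℂ)) := by
    rw [hx]
    ext i
    simp [sub_eq_add_neg]
  rw [hsx]
  conv_lhs => rw [hx]
  simp only [mulVec_add, mulVec_smul, sub_dotProduct, dotProduct_add, smul_dotProduct,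
    dotProduct_smul, smul_eq_mul, hv, hsymm]
  push_cast
  linear_combination (-(((b ⬝ᵥ S *ᵥ b : ℝ)) : ℂ)) * Complex.I_sq

open Matrix in
/-- Field of values bounds for `A K⁻¹ M` with `A = K - κ² M + i σ M`, from spectral bounds for the
real symmetric matrices `M` and `K`. -/
lemma HelmholtzFEM.fieldOfValues_subset_of_bounds {ι : Type*} [Fintype ι] [DecidableEq ι]
    {M K : Matrix ι ι ℝ} (hM : M.IsSymm) (hK : K.IsSymm) {m₀ m₁ C : ℝ} (hm₀ : 0 < m₀) (hC : 0 < C)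
    (hlow : ∀ a, m₀ * (a ⬝ᵥ a) ≤ a ⬝ᵥ M *ᵥ a) (hup : ∀ a, a ⬝ᵥ M *ᵥ a ≤ m₁ * (a ⬝ᵥ a))
    (hMK : ∀ a, a ⬝ᵥ M *ᵥ a ≤ C * (a ⬝ᵥ K *ᵥ a)) (κ : ℝ) {σ : ℝ} (hσ : 0 < σ) :
    fieldOfValues ((K.map ((↑) : ℝ → ℂ) + (-(κ : ℂ) ^ 2 + Complex.I * σ) • M.map ((↑) : ℝ → ℂ))
        * (K.map ((↑) : ℝ → ℂ))⁻¹ * M.map ((↑) : ℝ → ℂ)) ⊆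
      Set.Icc (m₀ - C * m₁ * κ ^ 2) m₁ ×ℂ Set.Icc 0 (C * m₁ * σ) := by
  have hpos : ∀ a : ι → ℝ, a ≠ 0 → 0 < a ⬝ᵥ a := fun a ha => by
    have := dotProduct_star_self_pos_iff.2 ha
    simpa using this
  have hnn : ∀ a : ι → ℝ, 0 ≤ a ⬝ᵥ a := fun a => by
    simpa using dotProduct_star_self_nonneg a
  have hM0 : ∀ a, 0 ≤ a ⬝ᵥ M *ᵥ a := fun a => (mul_nonneg hm₀.le (hnn a)).trans (hlow a)
  -- A kernel vector of `K` has nonpositive `M`-form by `hMK`, so it vanishes by `hlow`.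
  have hKd : IsUnit K.det := by
    rw [← Matrix.isUnit_iff_isUnit_det, ← Matrix.mulVec_injective_iff_isUnit]
    rw [← Matrix.coe_mulVecLin, ← LinearMap.ker_eq_bot, LinearMap.ker_eq_bot']
    intro a ha
    by_contra h
    rw [Matrix.mulVecLin_apply] at ha
    have h1 := (hlow a).trans (hMK a)
    rw [ha, dotProduct_zero, mul_zero] at h1
    exact absurd (mul_pos hm₀ (hpos a h)) (not_lt.2 h1)
  have hKK : K.map ((↑) : ℝ → ℂ) * K⁻¹.map ((↑) : ℝ → ℂ) = 1 := by
    have := (Matrix.map_mul (L := K) (M := K⁻¹) (f := Complex.ofRealHom)).symm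
    rw [Matrix.mul_nonsing_inv K hKd] at this
    exact this.trans (Matrix.map_one _ (map_zero _) (map_one _))
  have hinv := Matrix.inv_eq_right_inv hKK
  have hPs : (M * K⁻¹ * M).IsSymm := by
    rw [Matrix.IsSymm, transpose_mul, transpose_mul, transpose_nonsing_inv, hK.eq, hM.eq,
      Matrix.mul_assoc]
  have hPm : (M * K⁻¹ * M).map ((↑) : ℝ → ℂ)
      = M.map ((↑) : ℝ → ℂ) * K⁻¹.map ((↑) : ℝ → ℂ) * M.map ((↑) : ℝ → ℂ) := by
    have h1 := Matrix.map_mul (L := M * K⁻¹) (M := M) (f := Complex.ofRealHom)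
    have h2 := Matrix.map_mul (L := M) (M := K⁻¹) (f := Complex.ofRealHom)
    rw [h2] at h1
    exact h1
  have hB : (K.map ((↑) : ℝ → ℂ) + (-(κ : ℂ) ^ 2 + Complex.I * σ) • M.map ((↑) : ℝ → ℂ))
        * (K.map ((↑) : ℝ → ℂ))⁻¹ * M.map ((↑) : ℝ → ℂ)
      = M.map ((↑) : ℝ → ℂ)
        + (-(κ : ℂ) ^ 2 + Complex.I * σ) • (M * K⁻¹ * M).map ((↑) : ℝ → ℂ) := by
    rw [hinv, hPm, Matrix.add_mul, Matrix.add_mul, hKK, one_mul, Matrix.smul_mul,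
      Matrix.smul_mul]
  rw [hB]
  rintro z ⟨x, hx, rfl⟩
  set a : ι → ℝ := fun i => (x i).re with ha
  set b : ι → ℝ := fun i => (x i).im with hb
  have hn : star x ⬝ᵥ x = ((a ⬝ᵥ a + b ⬝ᵥ b : ℝ) : ℂ) := by
    have := star_dotProduct_map_ofReal_mulVec (Matrix.isSymm_one (n := ι) (α := ℝ)) x
    rw [Matrix.map_one _ (by simp) (by simp)] at this
    simpa using this
  have hn0 : 0 < a ⬝ᵥ a + b ⬝ᵥ b := by
    by_cases h : a = 0
    · have : b ≠ 0 := by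
        intro h'
        refine hx (funext fun i => Complex.ext ?_ ?_)
        · exact congrFun h i
        · exact congrFun h' i
      have := hpos b this
      have := hnn a
      linarith
    · have := hpos a h
      have := hnn b
      linarith
  have hmq : star x ⬝ᵥ (M.map ((↑) : ℝ → ℂ)
        + (-(κ : ℂ) ^ 2 + Complex.I * σ) • (M * K⁻¹ * M).map ((↑) : ℝ → ℂ)) *ᵥ x
      = ((a ⬝ᵥ M *ᵥ a + b ⬝ᵥ M *ᵥ b : ℝ) : ℂ) + (-(κ : ℂ) ^ 2 + Complex.I * σ)
        * ((a ⬝ᵥ (M * K⁻¹ * M) *ᵥ a + b ⬝ᵥ (M * K⁻¹ * M) *ᵥ b : ℝ) : ℂ) := by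
    rw [add_mulVec, smul_mulVec, dotProduct_add, dotProduct_smul,
      star_dotProduct_map_ofReal_mulVec hM, star_dotProduct_map_ofReal_mulVec hPs, smul_eq_mul]
  have qa := dotProduct_mul_inv_mul_mulVec_mem_Icc hM hKd hC hM0 hMK a
  have qb := dotProduct_mul_inv_mul_mulVec_mem_Icc hM hKd hC hM0 hMK b
  have la := hlow a
  have lb := hlow b
  have ua := hup a
  have ub := hup b
  rw [hmq, hn]
  have hm1 : a ⬝ᵥ M *ᵥ a + b ⬝ᵥ M *ᵥ b ≤ m₁ * (a ⬝ᵥ a + b ⬝ᵥ b) := by linarith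
  have hm0 : m₀ * (a ⬝ᵥ a + b ⬝ᵥ b) ≤ a ⬝ᵥ M *ᵥ a + b ⬝ᵥ M *ᵥ b := by linarith
  have hq0 := add_nonneg qa.1 qb.1
  have hq1 : a ⬝ᵥ (M * K⁻¹ * M) *ᵥ a + b ⬝ᵥ (M * K⁻¹ * M) *ᵥ b
      ≤ C * (a ⬝ᵥ M *ᵥ a + b ⬝ᵥ M *ᵥ b) := by linarith [qa.2, qb.2]
  -- What remains concerns three reals with `m₀ n ≤ m ≤ m₁ n` and `0 ≤ q ≤ C m`: the quotient is `(m
  -- - κ² q) / n + i σ q / n`.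
  generalize a ⬝ᵥ a + b ⬝ᵥ b = n at *
  generalize a ⬝ᵥ M *ᵥ a + b ⬝ᵥ M *ᵥ b = m at *
  generalize a ⬝ᵥ (M * K⁻¹ * M) *ᵥ a + b ⬝ᵥ (M * K⁻¹ * M) *ᵥ b = q at *
  have hz : ((m : ℂ) + (-(κ : ℂ) ^ 2 + Complex.I * σ) * (q : ℂ)) / (n : ℂ)
      = (((m - κ ^ 2 * q) / n : ℝ) : ℂ) + ((σ * q / n : ℝ) : ℂ) * Complex.I := by
    push_cast
    ring
  have hq2 : q ≤ C * (m₁ * n) := hq1.trans (by gcongr)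
  have hκ := mul_le_mul_of_nonneg_left hq2 (sq_nonneg κ)
  have hκ0 := mul_nonneg (sq_nonneg κ) hq0
  have hs := mul_le_mul_of_nonneg_left hq2 hσ.le
  rw [hz, Complex.mem_reProdIm]
  simp only [Complex.add_re, Complex.ofReal_re, Complex.re_ofReal_mul, Complex.I_re, mul_zero,
    add_zero, Complex.add_im, Complex.ofReal_im, Complex.im_ofReal_mul, Complex.I_im, mul_one,
    zero_add, Set.mem_Icc]
  refine ⟨⟨?_, ?_⟩, by positivity, ?_⟩
  · rw [le_div_iff₀ hn0]
    linarith
  · rw [div_le_iff₀ hn0]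
    linarith
  · rw [div_le_iff₀ hn0]
    linarith

/-! ### Gram matrices, and the mass and stiffness matrices as real matrices -/

/-- The Gram matrix of a family of real functions in `L²(μ)`. -/
noncomputable def gramL2 {ι X : Type*} [MeasurableSpace X] (μ : Measure X) (f : ι → X → ℝ) :
    Matrix ι ι ℝ :=
  Matrix.of fun j i => ∫ x, f i x * f j x ∂μ

lemma gramL2_isSymm {ι X : Type*} [MeasurableSpace X] (μ : Measure X) (f : ι → X → ℝ) :
    (gramL2 μ f).IsSymm := by
  ext i j
  simp only [gramL2, Matrix.transpose_apply, Matrix.of_apply, mul_comm]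

open Matrix in
lemma dotProduct_gramL2_mulVec {ι X : Type*} [Fintype ι] [MeasurableSpace X] {μ : Measure X}
    {f : ι → X → ℝ} (hf : ∀ i, MemLp (f i) 2 μ) (a : ι → ℝ) :
    a ⬝ᵥ gramL2 μ f *ᵥ a = ∫ x, (∑ i, a i * f i x) ^ 2 ∂μ := by
  have hint : ∀ i j, Integrable (fun x => f i x * f j x) μ := fun i j =>
    (hf i).integrable_mul (hf j)
  have h : ∀ x, (∑ i, a i * f i x) ^ 2 = ∑ j, ∑ i, a j * (f i x * f j x * a i) := fun x => by
    rw [sq, Finset.sum_mul_sum]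
    exact Finset.sum_congr rfl fun j _ => Finset.sum_congr rfl fun i _ => by ring
  simp only [h]
  rw [integral_finsetSum _ fun j _ => integrable_finsetSum _ fun i _ =>
    ((hint i j).mul_const _).const_mul _]
  refine Finset.sum_congr rfl fun j _ => ?_
  rw [integral_finsetSum _ fun i _ => ((hint i j).mul_const _).const_mul _]
  simp only [mulVec, dotProduct, Finset.mul_sum, integral_const_mul, integral_mul_const]
  rfl

namespace HelmholtzFEM

namespace Triangulation

variable {d : ℕ} {Ω : Set (E d)}

/-- The finite element function with nodal values `a`, extended by zero to the whole space. -/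
noncomputable def feFun (T : Triangulation Ω) (a : T.nodes → ℝ) (x : E d) : ℝ :=
  ∑ p, a p * T.bary x p

lemma exists_lipschitzWith_feFun (hΩ : IsPolyhedralDomain Ω) (T : Triangulation Ω)
    (a : T.nodes → ℝ) : ∃ L, LipschitzWith L (T.feFun a) := by
  choose L hL using fun p : T.nodes => T.exists_lipschitzWith_bary hΩ (T.mem_of_mem_nodes p)
  refine ⟨∑ p, ‖a p‖₊ * L p, LipschitzWith.of_dist_le_mul fun x y => ?_⟩
  rw [Real.dist_eq, feFun, feFun, ← Finset.sum_sub_distrib]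
  refine (Finset.abs_sum_le_sum_abs _ _).trans ?_
  push_cast
  rw [Finset.sum_mul]
  refine Finset.sum_le_sum fun p _ => ?_
  rw [← mul_sub, abs_mul, mul_assoc]
  exact mul_le_mul_of_nonneg_left ((hL p).dist_le_mul x y) (abs_nonneg _)

lemma bary_eq_zero_of_notMem (hΩ : IsPolyhedralDomain Ω) (T : Triangulation Ω) (p : T.nodes)
    {x : E d} (hx : x ∉ Ω) : T.bary x p = 0 := by
  by_contra h
  exact hx (T.mem_of_bary_ne_zero hΩ (T.mem_of_mem_nodes p) h)

lemma feFun_eq_zero_of_notMem (hΩ : IsPolyhedralDomain Ω) (T : Triangulation Ω)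
    (a : T.nodes → ℝ) {x : E d} (hx : x ∉ Ω) : T.feFun a x = 0 :=
  Finset.sum_eq_zero fun p _ => by rw [T.bary_eq_zero_of_notMem hΩ p hx, mul_zero]

lemma hasCompactSupport_of_eq_zero (hΩ : IsPolyhedralDomain Ω) {u : E d → ℝ}
    (hu : ∀ x, x ∉ Ω → u x = 0) : HasCompactSupport u :=
  HasCompactSupport.intro hΩ.isCompact_closure fun x hx => hu x fun h => hx (subset_closure h)

/-- By Rademacher's theorem the finitely many basis functions are simultaneously differentiable
almost everywhere, and at such points line derivatives add up. -/
lemma partialDeriv_feFun_ae (hΩ : IsPolyhedralDomain Ω) (T : Triangulation Ω)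
    (a : T.nodes → ℝ) (k : Fin d) :
    ∀ᵐ x, partialDeriv (T.feFun a) k x = ∑ p, a p * partialDeriv (fun x => T.bary x p) k x := by
  have h : ∀ᵐ x, ∀ p : T.nodes, DifferentiableAt ℝ (fun x => T.bary x p) x := by
    rw [ae_all_iff]
    intro p
    obtain ⟨L, hL⟩ := T.exists_lipschitzWith_bary hΩ (T.mem_of_mem_nodes p)
    exact hL.ae_differentiableAt
  filter_upwards [h] with x hx
  have h1 : HasFDerivAt (T.feFun a) (∑ p, a p • fderiv ℝ (fun x => T.bary x p) x) x :=
    HasFDerivAt.fun_sum fun p _ => (hx p).hasFDerivAt.const_mul (a p)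
  rw [partialDeriv, (h1.hasLineDerivAt _).lineDeriv]
  simp only [partialDeriv, (hx _).lineDeriv_eq_fderiv]
  simp

/-- The real mass matrix. -/
noncomputable def realMass (T : Triangulation Ω) : Matrix T.nodes T.nodes ℝ :=
  gramL2 (volume.restrict Ω) fun p x => T.bary x p

/-- The real stiffness matrix. -/
noncomputable def realStiffness (T : Triangulation Ω) : Matrix T.nodes T.nodes ℝ :=
  ∑ k, gramL2 (volume.restrict Ω) fun p => partialDeriv (fun x => T.bary x p) k

lemma realStiffness_isSymm (T : Triangulation Ω) : T.realStiffness.IsSymm := by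
  rw [Matrix.IsSymm, realStiffness, Matrix.transpose_sum]
  exact Finset.sum_congr rfl fun k _ => gramL2_isSymm _ _

lemma memLp_bary (hΩ : IsPolyhedralDomain Ω) (T : Triangulation Ω) (p : T.nodes) :
    MemLp (fun x => T.bary x p) 2 (volume.restrict Ω) := by
  obtain ⟨L, hL⟩ := T.exists_lipschitzWith_bary hΩ (T.mem_of_mem_nodes p)
  exact (hL.continuous.memLp_of_hasCompactSupport
    (hasCompactSupport_of_eq_zero hΩ fun x => T.bary_eq_zero_of_notMem hΩ p)).restrict Ω

lemma memLp_partialDeriv_bary (hΩ : IsPolyhedralDomain Ω) (T : Triangulation Ω) (p : T.nodes)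
    (k : Fin d) : MemLp (partialDeriv (fun x => T.bary x p) k) 2 (volume.restrict Ω) := by
  have := hΩ.isFiniteMeasure
  obtain ⟨L, hL⟩ := T.exists_lipschitzWith_bary hΩ (T.mem_of_mem_nodes p)
  exact memLp_two_partialDeriv hL k _

lemma massMatrix_eq_map (T : Triangulation Ω) :
    massMatrix T = T.realMass.map ((↑) : ℝ → ℂ) := by
  ext j i
  simp only [massMatrix, galerkinMatrix, massForm, nodalBasis, realMass, gramL2, Matrix.of_apply,
    Matrix.map_apply, ← integral_complex_ofReal]
  simp

lemma stiffnessMatrix_eq_map (hΩ : IsPolyhedralDomain Ω) (T : Triangulation Ω) :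
    stiffnessMatrix T = T.realStiffness.map ((↑) : ℝ → ℂ) := by
  have := hΩ.isFiniteMeasure
  ext j i
  have hae : ∀ p : T.nodes, ∀ᵐ x ∂volume.restrict Ω, ∀ k,
      weakGrad Ω (T.nodalBasis p) x k = partialDeriv (fun x => T.bary x p) k x := fun p => by
    obtain ⟨L, hL⟩ := T.exists_lipschitzWith_bary hΩ (T.mem_of_mem_nodes p)
    have h0 : ∀ x, x ∉ Ω → T.bary x p = 0 := fun x => T.bary_eq_zero_of_notMem hΩ p
    exact weakGrad_ae_eq hΩ.isOpen hL (hasCompactSupport_of_eq_zero hΩ h0) h0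
  have h1 : stiffnessMatrix T j i = ∫ x in Ω, ((∑ k, partialDeriv (fun x => T.bary x i) k x
      * partialDeriv (fun x => T.bary x j) k x : ℝ) : ℂ) := by
    refine integral_congr_ae ?_
    filter_upwards [hae i, hae j] with x hi hj
    simp [hi, hj]
  have h2 : ∀ k, Integrable (fun x => partialDeriv (fun x => T.bary x i) k x
      * partialDeriv (fun x => T.bary x j) k x) (volume.restrict Ω) := fun k =>
    (T.memLp_partialDeriv_bary hΩ i k).integrable_mul (T.memLp_partialDeriv_bary hΩ j k)
  rw [h1, integral_complex_ofReal, integral_finsetSum _ fun k _ => h2 k]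
  simp [realStiffness, Matrix.sum_apply, gramL2]

lemma systemMatrix_eq (T : Triangulation Ω) (κ σ : ℝ) :
    systemMatrix T κ σ = stiffnessMatrix T
      + (-(κ : ℂ) ^ 2 + Complex.I * σ) • massMatrix T := by
  ext j i
  simp only [systemMatrix, stiffnessMatrix, massMatrix, galerkinMatrix, helmholtzForm,
    Matrix.of_apply, Matrix.add_apply, Matrix.smul_apply, smul_eq_mul]
  have h : massForm Ω (fun x => (σ : ℂ) * T.nodalBasis i x) (T.nodalBasis j)
      = σ * massForm Ω (T.nodalBasis i) (T.nodalBasis j) := by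
    simp only [massForm, mul_assoc, integral_const_mul]
  rw [h]
  ring

open Matrix in
lemma dotProduct_realMass_mulVec (hΩ : IsPolyhedralDomain Ω) (T : Triangulation Ω)
    (a : T.nodes → ℝ) : a ⬝ᵥ T.realMass *ᵥ a = ∫ x in Ω, T.feFun a x ^ 2 :=
  dotProduct_gramL2_mulVec (T.memLp_bary hΩ) a

open Matrix in
/-- Poincaré's inequality in matrix form. -/
lemma realMass_le_realStiffness (hΩ : IsPolyhedralDomain Ω) (hd : 0 < d) (T : Triangulation Ω)
    {R : ℝ} (hR : ∀ x ∈ Ω, ‖x‖ ≤ R) (a : T.nodes → ℝ) :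
    a ⬝ᵥ T.realMass *ᵥ a ≤ 4 * R ^ 2 * (a ⬝ᵥ T.realStiffness *ᵥ a) := by
  have := hΩ.isFiniteMeasure
  obtain ⟨L, hL⟩ := T.exists_lipschitzWith_feFun hΩ a
  have h0 : ∀ x, x ∉ Ω → T.feFun a x = 0 := fun x => T.feFun_eq_zero_of_notMem hΩ a
  rw [T.dotProduct_realMass_mulVec hΩ]
  -- A single coordinate direction suffices; the other directions only add nonnegative terms to the
  -- stiffness form.
  refine (integral_sq_le_integral_partialDeriv_sq hΩ.isOpen.measurableSet hL
    (hasCompactSupport_of_eq_zero hΩ h0) h0 hR ⟨0, hd⟩).trans ?_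
  refine mul_le_mul_of_nonneg_left ?_ (by positivity)
  have h1 : ∀ k : Fin d, a ⬝ᵥ gramL2 (volume.restrict Ω)
      (fun p : T.nodes => partialDeriv (fun x => T.bary x p) k) *ᵥ a
      = ∫ x in Ω, partialDeriv (T.feFun a) k x ^ 2 := fun k => by
    rw [dotProduct_gramL2_mulVec fun p => T.memLp_partialDeriv_bary hΩ p k]
    refine integral_congr_ae ?_
    filter_upwards [ae_restrict_of_ae (T.partialDeriv_feFun_ae hΩ a k)] with x hx
    rw [hx]
  rw [realStiffness, sum_mulVec, dotProduct_sum]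
  simp only [h1]
  exact Finset.single_le_sum (f := fun k => ∫ x in Ω, partialDeriv (T.feFun a) k x ^ 2)
    (fun k _ => integral_nonneg fun x => sq_nonneg _) (Finset.mem_univ _)

/-- The points `x` and `p` share a cell, whose diameter is at most `h`. This confines the basis
function at `p` to a ball of radius `h`. -/
lemma norm_sub_le_of_bary_ne_zero {γ h : ℝ} (T : Triangulation Ω) (hT : T.IsQuasiUniform γ h)
    {x p : E d} (hx : T.bary x p ≠ 0) : ‖x - p‖ ≤ h := by
  obtain ⟨s, hs, hps, hxs⟩ := T.exists_cell_of_bary_ne_zero hx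
  rw [← dist_eq_norm]
  refine (Metric.dist_le_diam_of_mem ?_ hxs (subset_convexHull ℝ _ hps)).trans (hT s hs).1
  exact (s.finite_toSet.isCompact_convexHull ℝ).isBounded

/-- As `Ω` is nonempty there is a cell, and it has two distinct vertices at distance at most `h`. -/
lemma meshSize_pos (hΩ : IsPolyhedralDomain Ω) (hd : 0 < d) {γ h : ℝ} (T : Triangulation Ω)
    (hT : T.IsQuasiUniform γ h) : 0 < h := by
  obtain ⟨x, hx⟩ := hΩ.isConnected.nonempty
  obtain ⟨s, hs, -⟩ := T.exists_cell (subset_closure hx)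
  obtain ⟨p, hp, q, hq, hpq⟩ := Finset.one_lt_card.1 (show 1 < s.card by rw [hs.2]; omega)
  refine (dist_pos.2 hpq).trans_le ((Metric.dist_le_diam_of_mem ?_ (subset_convexHull ℝ _ hp)
    (subset_convexHull ℝ _ hq)).trans (hT s hs).1)
  exact (s.finite_toSet.isCompact_convexHull ℝ).isBounded

open Matrix in
/-- The upper bound for the mass matrix. -/
lemma realMass_le (hΩ : IsPolyhedralDomain Ω) {γ h : ℝ} (hh : 0 < h)
    (T : Triangulation Ω) (hT : T.IsQuasiUniform γ h) (a : T.nodes → ℝ) :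
    a ⬝ᵥ T.realMass *ᵥ a ≤ volume.real (Metric.ball (0 : E d) 1) * h ^ d * (a ⬝ᵥ a) := by
  have := hΩ.isFiniteMeasure
  rw [T.dotProduct_realMass_mulVec hΩ]
  have hi : ∀ p : T.nodes, Integrable (fun x => T.bary x p) (volume.restrict Ω) := fun p =>
    (T.memLp_bary hΩ p).integrable (by norm_num)
  -- Cauchy–Schwarz with the coordinates as weights, whose sum is at most one. No bound on the
  -- number of overlapping basis functions is needed.
  have hpt : ∀ x, T.feFun a x ^ 2 ≤ ∑ p, a p ^ 2 * T.bary x p := fun x => by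
    have h1 := Finset.sum_sq_le_sum_mul_sum_of_sq_le_mul (Finset.univ : Finset T.nodes)
      (r := fun p => a p * T.bary x p) (f := fun p => T.bary x p)
      (g := fun p => a p ^ 2 * T.bary x p) (fun p _ => T.bary_nonneg x p)
      (fun p _ => mul_nonneg (sq_nonneg _) (T.bary_nonneg x p))
      (fun p _ => le_of_eq (by ring))
    refine h1.trans (mul_le_of_le_one_left ?_ ?_)
    · exact Finset.sum_nonneg fun p _ => mul_nonneg (sq_nonneg _) (T.bary_nonneg x p)
    · rw [Finset.sum_coe_sort T.nodes (fun p => T.bary x p)]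
      exact T.sum_bary_le_one _ x
  have hb : ∀ p : T.nodes, ∫ x in Ω, T.bary x p
      ≤ volume.real (Metric.ball (0 : E d) 1) * h ^ d := fun p => by
    have h1 : ∫ x in Ω, T.bary x p ≤ ∫ x in Ω, (Metric.closedBall (p : E d) h).indicator 1 x := by
      refine integral_mono (hi p)
        ((integrable_const (1 : ℝ)).indicator Metric.isClosed_closedBall.measurableSet) fun x => ?_
      by_cases hx : T.bary x p = 0
      · simp only [hx]
        exact Set.indicator_nonneg (fun _ _ => zero_le_one) x
      · have hxp := T.norm_sub_le_of_bary_ne_zero hT hx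
        rw [Set.indicator_of_mem (by rwa [mem_closedBall_iff_norm])]
        exact T.bary_le_one x p
    rw [integral_indicator_one Metric.isClosed_closedBall.measurableSet] at h1
    refine h1.trans ?_
    have h2 : volume.real (Metric.closedBall (p : E d) h)
        = h ^ d * volume.real (Metric.ball (0 : E d) 1) := by
      rw [Measure.real, Measure.addHaar_closedBall _ _ hh.le, ENNReal.toReal_mul,
        ENNReal.toReal_ofReal (by positivity), finrank_euclideanSpace_fin, Measure.real]
    rw [mul_comm, ← h2]
    exact ENNReal.toReal_mono measure_closedBall_lt_top.ne (Measure.restrict_apply_le _ _)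
  calc ∫ x in Ω, T.feFun a x ^ 2 ≤ ∫ x in Ω, ∑ p, a p ^ 2 * T.bary x p := by
        refine integral_mono_of_nonneg (Filter.Eventually.of_forall fun x => sq_nonneg _)
          (integrable_finsetSum _ fun p _ => (hi p).const_mul _)
          (Filter.Eventually.of_forall hpt)
    _ = ∑ p, a p ^ 2 * ∫ x in Ω, T.bary x p := by
        rw [integral_finsetSum _ fun p _ => (hi p).const_mul _]
        simp only [integral_const_mul]
    _ ≤ ∑ p, a p ^ 2 * (volume.real (Metric.ball (0 : E d) 1) * h ^ d) :=
        Finset.sum_le_sum fun p _ => mul_le_mul_of_nonneg_left (hb p) (sq_nonneg _)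
    _ = volume.real (Metric.ball (0 : E d) 1) * h ^ d * (a ⬝ᵥ a) := by
        rw [dotProduct, Finset.mul_sum]
        exact Finset.sum_congr rfl fun p _ => by ring

end Triangulation

end HelmholtzFEM

/-! ### The lower bound for the mass matrix -/

namespace HelmholtzFEM

namespace Triangulation

variable {d : ℕ} {Ω : Set (E d)}

/-- A nonempty open overlap would lie in the convex hull of the common vertices. These would then
span the whole space affinely, so there would be `d + 1` of them and the cells would coincide. -/
lemma disjoint_of_subset_cells (T : Triangulation Ω) {s t : Finset (E d)} (hs : s ∈ T.cells)
    (ht : t ∈ T.cells) (hst : s ≠ t) {U V : Set (E d)} (hU : IsOpen U) (hV : IsOpen V)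
    (hUs : U ⊆ convexHull ℝ (s : Set (E d))) (hVt : V ⊆ convexHull ℝ (t : Set (E d))) :
    Disjoint U V := by
  classical
  rw [Set.disjoint_iff_inter_eq_empty]
  by_contra hne
  have hspan := (hU.inter hV).affineSpan_eq_top (Set.nonempty_iff_ne_empty.2 hne)
  have hsub : U ∩ V ⊆ convexHull ℝ ((s ∩ t : Finset (E d)) : Set (E d)) := fun x hx => by
    rw [Finset.coe_inter]
    exact T.inter_subset_convexHull hs.1 ht.1 ⟨hUs hx.1, hVt hx.2⟩
  have htop : affineSpan ℝ ((s ∩ t : Finset (E d)) : Set (E d)) = ⊤ := by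
    rw [← affineSpan_convexHull, eq_top_iff, ← hspan]
    exact affineSpan_mono ℝ hsub
  have hind : AffineIndependent ℝ ((↑) : (s ∩ t : Finset (E d)) → E d) :=
    (T.indep hs.1).mono (by exact_mod_cast Finset.inter_subset_left)
  have hcard := hind.affineSpan_eq_top_iff_card_eq_finrank_add_one.1 (by
    rw [← htop]; congr 1; exact Subtype.range_coe)
  rw [Fintype.card_coe, finrank_euclideanSpace_fin] at hcard
  have e1 := Finset.eq_of_subset_of_card_le (Finset.inter_subset_left (s₁ := s) (s₂ := t))
    (by rw [hcard, hs.2])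
  have e2 := Finset.eq_of_subset_of_card_le (Finset.inter_subset_right (s₁ := s) (s₂ := t))
    (by rw [hcard, ht.2])
  exact hst (e1.symm.trans e2)

/-- Every element contains a ball on which an affine function is bounded from below by its nodal
values. -/
lemma exists_ball_sum_sq_le {γ h : ℝ} (hγ : 0 < γ) (T : Triangulation Ω)
    (hT : T.IsQuasiUniform γ h) {s : Finset (E d)} (hs : s ∈ T.cells) (y : E d → ℝ) :
    ∃ b : E d, Metric.ball b (h / (4 * γ)) ⊆ convexHull ℝ (s : Set (E d)) ∧
      ∀ z ∈ Metric.ball b (h / (4 * γ)),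
        ∑ q ∈ s, y q ^ 2 ≤ 4 * (d + 1) * (∑ q ∈ s, y q * T.bary z q) ^ 2 := by
  classical
  obtain ⟨c, hc⟩ := (hT s hs).2
  have hsne : s.Nonempty := Finset.card_pos.1 (by rw [hs.2]; omega)
  -- The ball sought is the image of the inscribed ball under the homothety with ratio `1/4` centred
  -- at this vertex, so the coordinate of `v` is at least `3/4` on it.
  obtain ⟨v, hv, hmax⟩ := s.exists_max_image (fun q => |y q|) hsne
  have hpt : ∀ z ∈ Metric.ball (AffineMap.lineMap v c (1 / 4 : ℝ)) (h / (4 * γ)),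
      ∃ w ∈ convexHull ℝ (s : Set (E d)), z = AffineMap.lineMap v w (1 / 4 : ℝ) := by
    intro z hz
    refine ⟨v + (4 : ℝ) • (z - v), hc ?_, ?_⟩
    · rw [mem_ball_iff_norm] at hz
      rw [mem_closedBall_iff_norm]
      have h1 : v + (4 : ℝ) • (z - v) - c = (4 : ℝ) • (z - AffineMap.lineMap v c (1 / 4 : ℝ)) := by
        rw [AffineMap.lineMap_apply_module]
        module
      rw [h1, norm_smul, Real.norm_ofNat]
      have h2 : h / γ = 4 * (h / (4 * γ)) := by field_simp
      rw [h2]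
      linarith
    · rw [AffineMap.lineMap_apply_module]
      module
  have hvs : v ∈ convexHull ℝ (s : Set (E d)) := subset_convexHull ℝ _ hv
  have hsub : Metric.ball (AffineMap.lineMap v c (1 / 4 : ℝ)) (h / (4 * γ))
      ⊆ convexHull ℝ (s : Set (E d)) := by
    intro z hz
    obtain ⟨w, hw, rfl⟩ := hpt z hz
    exact (convex_convexHull ℝ (s : Set (E d))).lineMap_mem hvs hw ⟨by norm_num, by norm_num⟩
  refine ⟨_, hsub, fun z hz => ?_⟩
  obtain ⟨b0, -, b2, -⟩ := T.isBarycentric_bary hs (hsub hz)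
  have hbv : 3 / 4 ≤ T.bary z v := by
    rw [T.bary_eq_coord hs (hsub hz) ⟨v, hv⟩]
    obtain ⟨w, hw, rfl⟩ := hpt z hz
    have h1 := (T.mem_convexHull_iff_coord hs).1 hw ⟨v, hv⟩
    have h2 : (T.cellBasis hs).coord ⟨v, hv⟩ v = 1 := (T.cellBasis hs).coord_apply_eq ⟨v, hv⟩
    rw [AffineMap.apply_lineMap, h2, AffineMap.lineMap_apply_module]
    simp only [smul_eq_mul]
    linarith
  have hrest : |∑ q ∈ s.erase v, y q * T.bary z q| ≤ |y v| * (1 - T.bary z v) := by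
    refine (Finset.abs_sum_le_sum_abs _ _).trans ?_
    have h1 : ∑ q ∈ s.erase v, T.bary z q = 1 - T.bary z v := by
      rw [← b2, ← Finset.add_sum_erase s _ hv]
      ring
    rw [← h1, Finset.mul_sum]
    refine Finset.sum_le_sum fun q hq => ?_
    rw [abs_mul, abs_of_nonneg (b0 q)]
    exact mul_le_mul_of_nonneg_right (hmax q (Finset.mem_of_mem_erase hq)) (b0 q)
  -- The vertex `v` contributes at least `3/4 |y v|`, the others together at most `1/4 |y v|`.
  have hlow : |y v| / 2 ≤ |∑ q ∈ s, y q * T.bary z q| := by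
    rw [← Finset.add_sum_erase s _ hv]
    have h1 := abs_sub_abs_le_abs_add (y v * T.bary z v) (∑ q ∈ s.erase v, y q * T.bary z q)
    rw [abs_mul, abs_of_nonneg (b0 v)] at h1
    nlinarith [abs_nonneg (y v)]
  have hsum : ∑ q ∈ s, y q ^ 2 ≤ (d + 1) * y v ^ 2 := by
    have h1 := Finset.sum_le_card_nsmul s (fun q => y q ^ 2) (y v ^ 2)
      fun q hq => sq_le_sq.2 (hmax q hq)
    rw [hs.2, nsmul_eq_mul] at h1
    exact_mod_cast h1
  have hsq : y v ^ 2 ≤ 4 * (∑ q ∈ s, y q * T.bary z q) ^ 2 := by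
    rw [← sq_abs (y v), ← sq_abs (∑ q ∈ s, y q * T.bary z q)]
    nlinarith [abs_nonneg (y v)]
  calc ∑ q ∈ s, y q ^ 2 ≤ (d + 1) * y v ^ 2 := hsum
    _ ≤ (d + 1) * (4 * (∑ q ∈ s, y q * T.bary z q) ^ 2) := by gcongr
    _ = 4 * (d + 1) * (∑ q ∈ s, y q * T.bary z q) ^ 2 := by ring

open Classical in
/-- Nodal values, extended by zero to all points. -/
noncomputable def nodalExtension (T : Triangulation Ω) (a : T.nodes → ℝ) (q : E d) : ℝ :=
  if h : q ∈ T.nodes then a ⟨q, h⟩ else 0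

/-- Nodes outside the cell have coordinate zero, and vertices of the cell that are not nodes carry
the value zero. -/
lemma feFun_eq_sum_cell (T : Triangulation Ω) (a : T.nodes → ℝ) {s : Finset (E d)}
    (hs : s ∈ T.cells) {z : E d} (hz : z ∈ convexHull ℝ (s : Set (E d))) :
    T.feFun a z = ∑ q ∈ s, T.nodalExtension a q * T.bary z q := by
  classical
  have h1 : T.feFun a z = ∑ q ∈ T.nodes, T.nodalExtension a q * T.bary z q := by
    rw [← Finset.sum_coe_sort T.nodes, feFun]
    simp [nodalExtension]
  have h2 : ∑ q ∈ T.nodes, T.nodalExtension a q * T.bary z q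
      = ∑ q ∈ T.nodes ∪ s, T.nodalExtension a q * T.bary z q :=
    Finset.sum_subset Finset.subset_union_left fun q _ hq => by
      rw [nodalExtension, dif_neg hq, zero_mul]
  have h3 : ∑ q ∈ s, T.nodalExtension a q * T.bary z q
      = ∑ q ∈ T.nodes ∪ s, T.nodalExtension a q * T.bary z q :=
    Finset.sum_subset Finset.subset_union_right fun q _ hq => by
      rw [(T.isBarycentric_bary hs hz).2.1 q hq, mul_zero]
  rw [h1, h2, h3]

lemma exists_cell_of_mem_nodes (T : Triangulation Ω) (p : T.nodes) :
    ∃ s ∈ T.cells, (p : E d) ∈ s := by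
  classical
  have h := (Finset.mem_filter.1 p.2).1
  simp only [Finset.mem_biUnion, Set.Finite.mem_toFinset, id] at h
  obtain ⟨s, hs, hps⟩ := h
  obtain ⟨t, ht, hst, hc⟩ := T.pure_dim s hs
  exact ⟨t, ⟨ht, hc⟩, hst hps⟩

open Matrix in
-- Each node belongs to at least one cell, so its square is counted at least once on the right.
lemma dotProduct_self_le_sum_cells (T : Triangulation Ω) (a : T.nodes → ℝ) :
    a ⬝ᵥ a ≤ ∑ s ∈ T.finite_cells.toFinset, ∑ q ∈ s, T.nodalExtension a q ^ 2 := by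
  classical
  have h1 : a ⬝ᵥ a = ∑ q ∈ T.nodes, T.nodalExtension a q ^ 2 := by
    rw [← Finset.sum_coe_sort T.nodes, dotProduct]
    simp [nodalExtension, sq]
  have h2 : ∑ s ∈ T.finite_cells.toFinset, ∑ q ∈ s, T.nodalExtension a q ^ 2
      = ∑ q ∈ T.finite_cells.toFinset.biUnion id,
        ∑ _s ∈ T.finite_cells.toFinset.filter (fun s => q ∈ s), T.nodalExtension a q ^ 2 := by
    refine Finset.sum_comm' fun s q => ?_
    simp only [Finset.mem_biUnion, Finset.mem_filter, id]
    exact ⟨fun h => ⟨h, s, h⟩, fun h => h.1⟩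
  have hsub : T.nodes ⊆ T.finite_cells.toFinset.biUnion id := by
    intro p hp
    obtain ⟨s, hs, hps⟩ := T.exists_cell_of_mem_nodes ⟨p, hp⟩
    exact Finset.mem_biUnion.2 ⟨s, T.finite_cells.mem_toFinset.2 hs, hps⟩
  rw [h1, h2]
  refine (Finset.sum_le_sum_of_subset_of_nonneg hsub fun q _ _ => sq_nonneg _).trans
    (Finset.sum_le_sum fun q hq => ?_)
  obtain ⟨s, hs, hqs⟩ := Finset.mem_biUnion.1 hq
  exact Finset.single_le_sum (f := fun _ : Finset (E d) => T.nodalExtension a q ^ 2)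
    (fun _ _ => sq_nonneg _) (Finset.mem_filter.2 ⟨hs, hqs⟩)

open Matrix in
/-- The lower bound for the mass matrix. -/
lemma le_realMass (hΩ : IsPolyhedralDomain Ω) {γ h : ℝ} (hγ : 0 < γ) (hh : 0 < h)
    (T : Triangulation Ω) (hT : T.IsQuasiUniform γ h) (a : T.nodes → ℝ) :
    volume.real (Metric.ball (0 : E d) 1) / ((4 * γ) ^ d * (4 * (d + 1))) * h ^ d * (a ⬝ᵥ a)
      ≤ a ⬝ᵥ T.realMass *ᵥ a := by
  classical
  have := hΩ.isFiniteMeasure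
  rw [T.dotProduct_realMass_mulVec hΩ]
  obtain ⟨L, hL⟩ := T.exists_lipschitzWith_feFun hΩ a
  have h0 : ∀ x, x ∉ Ω → T.feFun a x = 0 := fun x => T.feFun_eq_zero_of_notMem hΩ a
  have hint : Integrable (fun x => T.feFun a x ^ 2) volume :=
    (hL.continuous.memLp_of_hasCompactSupport (p := 2)
      (hasCompactSupport_of_eq_zero hΩ h0)).integrable_sq
  choose! b hb1 hb2 using fun s (hs : s ∈ T.cells) =>
    T.exists_ball_sum_sq_le hγ hT hs (T.nodalExtension a)
  set r := h / (4 * γ) with hr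
  have hr0 : 0 < r := by positivity
  set S := T.finite_cells.toFinset with hS
  have hmem : ∀ {s}, s ∈ S → s ∈ T.cells := fun h => T.finite_cells.mem_toFinset.1 h
  have hvol : ∀ s, volume.real (Metric.ball (b s) r)
      = r ^ d * volume.real (Metric.ball (0 : E d) 1) := fun s => by
    rw [Measure.real, Measure.addHaar_ball_of_pos _ _ hr0, ENNReal.toReal_mul,
      ENNReal.toReal_ofReal (by positivity), finrank_euclideanSpace_fin, Measure.real]
  have hcell : ∀ s ∈ S, r ^ d * volume.real (Metric.ball (0 : E d) 1)
      * (∑ q ∈ s, T.nodalExtension a q ^ 2)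
      ≤ 4 * (d + 1) * ∫ x in Metric.ball (b s) r, T.feFun a x ^ 2 := fun s hs => by
    rw [← hvol s, ← integral_const_mul, ← smul_eq_mul, ← setIntegral_const]
    refine setIntegral_mono_on (integrableOn_const measure_ball_lt_top.ne)
      (hint.integrableOn.const_mul _) measurableSet_ball fun z hz => ?_
    rw [T.feFun_eq_sum_cell a (hmem hs) (hb1 s (hmem hs) hz)]
    exact hb2 s (hmem hs) z hz
  -- The balls are disjoint, and since the function vanishes off `Ω` its integral over `Ω` is that
  -- over the whole space.
  have hsum : ∑ s ∈ S, ∫ x in Metric.ball (b s) r, T.feFun a x ^ 2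
      ≤ ∫ x in Ω, T.feFun a x ^ 2 := by
    rw [← integral_biUnion_finset S (fun s _ => measurableSet_ball)
      (fun s hs t ht hst => T.disjoint_of_subset_cells (hmem hs) (hmem ht) hst Metric.isOpen_ball
        Metric.isOpen_ball (hb1 s (hmem hs)) (hb1 t (hmem ht))) fun s _ => hint.integrableOn]
    rw [setIntegral_eq_integral_of_forall_compl_eq_zero
      (s := Ω) (fun x hx => by simp [h0 x hx])]
    exact setIntegral_le_integral hint (Filter.Eventually.of_forall fun x => sq_nonneg _)
  have hV : 0 ≤ volume.real (Metric.ball (0 : E d) 1) := measureReal_nonneg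
  have htot : r ^ d * volume.real (Metric.ball (0 : E d) 1) * (a ⬝ᵥ a)
      ≤ 4 * (d + 1) * ∫ x in Ω, T.feFun a x ^ 2 :=
    calc r ^ d * volume.real (Metric.ball (0 : E d) 1) * (a ⬝ᵥ a)
        ≤ r ^ d * volume.real (Metric.ball (0 : E d) 1)
          * ∑ s ∈ S, ∑ q ∈ s, T.nodalExtension a q ^ 2 := by
          gcongr
          exact T.dotProduct_self_le_sum_cells a
      _ ≤ ∑ s ∈ S, 4 * (d + 1) * ∫ x in Metric.ball (b s) r, T.feFun a x ^ 2 := by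
          rw [Finset.mul_sum]
          exact Finset.sum_le_sum hcell
      _ ≤ 4 * (d + 1) * ∫ x in Ω, T.feFun a x ^ 2 := by
          rw [← Finset.mul_sum]
          gcongr
  have e : volume.real (Metric.ball (0 : E d) 1) / ((4 * γ) ^ d * (4 * (d + 1))) * h ^ d * (a ⬝ᵥ a)
      = r ^ d * volume.real (Metric.ball (0 : E d) 1) * (a ⬝ᵥ a) / (4 * (d + 1)) := by
    rw [hr, div_pow]
    field_simp
  rw [e, div_le_iff₀ (by positivity), mul_comm _ (4 * ((d : ℝ) + 1))]
  exact htot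

end Triangulation

end HelmholtzFEM

/-! ### Choice of the constants and conclusion -/

theorem theorem4p1 (d : ℕ) (hd : d = 2 ∨ d = 3) (Ω : Set (HelmholtzFEM.E d))
    (hΩ : HelmholtzFEM.IsPolyhedralDomain Ω) (γ : ℝ) (hγ : 0 < γ) :
    ∃ c > (0 : ℝ), ∃ C > (0 : ℝ),
      ∀ (T : HelmholtzFEM.Triangulation Ω) (h : ℝ), T.IsQuasiUniform γ h →
        ∀ κ σ : ℝ, 0 < σ →
          HelmholtzFEM.fieldOfValues
              (HelmholtzFEM.systemMatrix T κ σ * (HelmholtzFEM.stiffnessMatrix T)⁻¹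
                * HelmholtzFEM.massMatrix T) ⊆
            Set.Icc (c * (1 - C * κ ^ 2) * h ^ d) (C * h ^ d) ×ℂ
              Set.Icc 0 (C * σ * h ^ d) := by
  have hd0 : 0 < d := by omega
  obtain ⟨R, hR0, hR⟩ : ∃ R > 0, ∀ x ∈ Ω, ‖x‖ ≤ R := by
    obtain ⟨R, hR0, hR⟩ := hΩ.isCompact_closure.isBounded.exists_pos_norm_le
    exact ⟨R, hR0, fun x hx => hR x (subset_closure hx)⟩
  set V := volume.real (Metric.ball (0 : HelmholtzFEM.E d) 1) with hV
  have hV0 : 0 < V :=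
    ENNReal.toReal_pos (Metric.measure_ball_pos _ _ one_pos).ne' measure_ball_lt_top.ne
  have hc0 : 0 < V / ((4 * γ) ^ d * (4 * (d + 1))) := by positivity
  set c := V / ((4 * γ) ^ d * (4 * (d + 1))) with hc
  have hP0 : 0 < 4 * R ^ 2 := by positivity
  set P := 4 * R ^ 2 with hP
  -- One summand for each bound: `V` for the real part from above, `P * V` for the imaginary part,
  -- and `P * V / c` for the real part from below, where the factor `c` stands outside the bracket.
  refine ⟨c, hc0, V + P * V + P * V / c, by positivity, fun T h hT κ σ hσ => ?_⟩
  have hh := T.meshSize_pos hΩ hd0 hT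
  have hhd : 0 < h ^ d := pow_pos hh d
  rw [T.systemMatrix_eq, T.stiffnessMatrix_eq_map hΩ, T.massMatrix_eq_map]
  refine (HelmholtzFEM.fieldOfValues_subset_of_bounds (gramL2_isSymm _ _) T.realStiffness_isSymm
    (mul_pos hc0 hhd) hP0 (T.le_realMass hΩ hγ hh hT) (T.realMass_le hΩ hh hT)
    (T.realMass_le_realStiffness hΩ hd0 hR) κ hσ).trans ?_
  have hPV : 0 < P * V := mul_pos hP0 hV0
  have hPVc : 0 < P * V / c := div_pos hPV hc0
  have hlow : c * (1 - (V + P * V + P * V / c) * κ ^ 2) * h ^ d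
      ≤ c * h ^ d - P * (V * h ^ d) * κ ^ 2 := by
    have h1 : c * (1 - (V + P * V + P * V / c) * κ ^ 2) * h ^ d
        = c * h ^ d - P * (V * h ^ d) * κ ^ 2 - c * (V + P * V) * κ ^ 2 * h ^ d := by
      field_simp
      ring
    have h2 : 0 ≤ c * (V + P * V) * κ ^ 2 * h ^ d := by positivity
    linarith
  have hre : V * h ^ d ≤ (V + P * V + P * V / c) * h ^ d := by
    gcongr
    linarith
  have him : P * (V * h ^ d) * σ ≤ (V + P * V + P * V / c) * σ * h ^ d := by
    have h1 : P * (V * h ^ d) * σ = P * V * σ * h ^ d := by ring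
    rw [h1]
    gcongr
    linarith
  intro z hz
  rw [Complex.mem_reProdIm] at hz ⊢
  exact ⟨Set.Icc_subset_Icc hlow hre hz.1, Set.Icc_subset_Icc le_rfl him hz.2⟩
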